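/- Let $n\ge 1$ and let $\Pi_{n+1}$ be the lattice of set partitions of $[n+1]=\{1,\dots,n+1\}$ ordered by refinement. If $x\lessdot y$ in $\Pi_{n+1}$, then $y$ arises from $x$ by merging exactly two blocks $B_1,B_2$; put $\lambda(x,y)=\max\{\min B_1,\min B_2\}$ (the max-min labeling). This is an EL-labeling: every interval $[x,y]$ with $x<y$ has a unique maximal chain with weakly increasing label sequence, and this chain lexicographically precedes all other maximal chains of $[x,y]$. For maximal chains $m,m'$ of $\Pi_{n+1}$ write $m\to m'$ if they agree except on an interval $[x,z]$ on which $m'$ is $x\lessdot y\lessdot z$ with $y\notin m$, the restriction of $m$ to $[x,z]$ is the unique ascending maximal chain of $[x,z]$, and $\lambda(x,y)\not\le\lambda(y,z)$. The maximal chain descent order $\Pi_{n+1}(\lambda)$ is the set of maximal chains of $\Pi_{n+1}$ with the reflexive transitive closure of $\to$; it is a partial order. Let $PT(n)$ be the set of rooted, unordered, full binary trees with vertices labeled $1,\dots,2n+1$ and leaf set $\{1,\dots,n+1\}$ which are decreasing, that is, every vertex has a larger label than each of its descendants. For $T\in PT(n)$ and $0\le i\le n$ let $x_i$ be the partition whose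 blocks are the leaf sets (the sets of those labels at most $n+1$) of the connected components of $T$ restricted to the vertices with label at most $n+1+i$, and let $c(T)=(x_0,x_1,\dots,x_n)$. For an internal vertex $v$ of $T$ let $\ell_T(v)$ be the maximum of the two minima of the leaf sets of the full subtrees rooted at the two children of $v$. For $T,S\in PT(n)$ write $T\rightharpoonup S$ if for some $1\le i\le n-1$ we have $\ell_T(n+1+i)<\ell_T(n+1+i+1)$ and one of the following holds: (i) $S$ is obtained from $T$ by swapping the labels $n+1+i$ and $n+1+i+1$; (ii) $n+1+i$ is a child of $n+1+i+1$ in $T$, and $S$ is obtained from $T$ by swapping the full subtree rooted at the other child of $n+1+i+1$ with a full subtree rooted at a child of $n+1+i$. Let $\preceq$ be the reflexive transitive closure of $\rightharpoonup$ on $PT(n)$. Then $\preceq$ is a partial order, $c(T)$ is a maximal chain $x_0\lessdot x_1\lessdot\dots\lessdot x_n$ of $\Pi_{n+1}$ from its least to its greatest element for each $T\in PT(n)$, and $c$ is a poset isomorphism from $(PT(n),\preceq)$ onto $\Pi_{n+1}(\lambda)$: it is a bijection from $PT(n)$ to the set of maximal chains of $\Pi_{n+1}$, and $T\preceq S$ if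 and only if $c(T)\le c(S)$ in the maximal chain descent order. Moreover, $S$ covers $T$ in $(PT(n),\preceq)$ if and only if $T\rightharpoonup S$. -/

import Mathlib

namespace ChainDescent

/-! ### Edge labelings and maximal chain descent orders -/

section Poset

variable {P : Type*} [PartialOrder P] {L : Type*} [PartialOrder L]

/-- The list `l` is a saturated chain `x = x₀ ⋖ x₁ ⋖ ⋯ ⋖ x_k = y`, i.e. (in a finite poset)
a maximal chain of the closed interval `[x, y]`. -/
def IsSaturatedChain (x y : P) (l : List P) : Prop :=
  l.IsChain (· ⋖ ·) ∧ l.head? = some x ∧ l.getLast? = some y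

/-- The label sequence `lam x₀ x₁, lam x₁ x₂, …` of a chain. An edge labeling is given as a function
`lam : P → P → L`, of which only the values on cover relations are ever used. -/
def labelSeq (lam : P → P → L) (l : List P) : List L :=
  List.zipWith lam l l.tail

/-- A chain is ascending if its label sequence is (weakly) increasing. -/
def IsAscending (lam : P → P → L) (l : List P) : Prop :=
  (labelSeq lam l).IsChain (· ≤ ·)

/-- At the first place where the sequences disagree, the first one has the smaller entry. -/
def LexPrecedes (a b : List L) : Prop :=
  ∃ (p s t : List L) (u v : L), u < v ∧ a = p ++ u :: s ∧ b = p ++ v :: t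

/-- `l` is the unique ascending maximal chain of `[x, y]`. -/
def IsUniqueAscending (lam : P → P → L) (x y : P) (l : List P) : Prop :=
  IsSaturatedChain x y l ∧ IsAscending lam l ∧
    ∀ l', IsSaturatedChain x y l' → IsAscending lam l' → l' = l

/-- EL-labelings (of a finite bounded poset): every interval `[x, y]` with `x < y` has a unique
ascending maximal chain, and it lexicographically precedes all other maximal chains of `[x, y]`. -/
def IsELLabeling (lam : P → P → L) : Prop :=
  ∀ x y : P, x < y → ∃ l, IsUniqueAscending lam x y l ∧
    ∀ l', IsSaturatedChain x y l' → l' ≠ l → LexPrecedes (labelSeq lam l) (labelSeq lam l')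

variable (P) in
/-- The maximal chains `⊥ = x₀ ⋖ x₁ ⋖ ⋯ ⋖ x_r = ⊤` of a finite bounded poset. -/
def MaxChain [OrderBot P] [OrderTop P] : Type _ :=
  {l : List P // IsSaturatedChain ⊥ ⊤ l}

/-- `m` increases by a polygon move to `m'`: the two chains agree except on an interval `[x, z]`, on
which `m'` is `x ⋖ y ⋖ z` with `y ∉ m`, `m` is the unique ascending maximal chain of `[x, z]`, and
`m'` has a descent at `y`. -/
def PolygonMove [OrderBot P] [OrderTop P] (lam : P → P → L) (m m' : MaxChain P) : Prop :=
  ∃ (p q s : List P) (x y z : P),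
    m.1 = p ++ (x :: q ++ [z]) ++ s ∧ m'.1 = p ++ [x, y, z] ++ s ∧ y ∉ m.1 ∧
    IsUniqueAscending lam x z (x :: q ++ [z]) ∧ ¬ lam x y ≤ lam y z

/-- The maximal chain descent order: the reflexive transitive closure of the polygon moves. -/
def DescentLE [OrderBot P] [OrderTop P] (lam : P → P → L) : MaxChain P → MaxChain P → Prop :=
  Relation.ReflTransGen (PolygonMove lam)

end Poset

/-- `b` covers `a` with respect to the partial order `r`. -/
def CoversIn {α : Type*} (r : α → α → Prop) (a b : α) : Prop :=
  r a b ∧ a ≠ b ∧ ∀ z, r a z → r z b → z = a ∨ z = b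

/-! ### The partition lattice -/

/-- The lattice of set partitions of `{1, …, n + 1}`, ordered by refinement. -/
abbrev PartitionLattice (n : ℕ) : Type := Finpartition (Finset.Icc 1 (n + 1))

/-- The max-min labeling. If `x ⋖ y`, then `y` is obtained from `x` by merging two blocks `B₁, B₂`,
which are exactly the blocks of `x` that are not blocks of `y`; the label is
`max (min B₁) (min B₂)`. -/
noncomputable def maxMinLabel (n : ℕ) (x y : PartitionLattice n) : ℕ :=
  (x.parts \ y.parts).sup fun B => sInf (B : Set ℕ)

/-! ### Trees -/

/-- Rooted, unordered, decreasing, full binary trees with vertex set `{1, …, 2n + 1}` and leaf set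
`{1, …, n + 1}`, given by their root and the (unordered) sets of children of the vertices.
As the tree is decreasing, the root is reached from each vertex by passing to parents. -/
@[ext]
structure DecTree (n : ℕ) where
  root : ℕ
  /-- the set of children of a vertex (empty for numbers that are not vertices) -/
  children : ℕ → Finset ℕ
  root_mem : root ∈ Finset.Icc 1 (2 * n + 1)
  children_subset : ∀ v, children v ⊆ Finset.Icc 1 (2 * n + 1)
  /-- each non-leaf vertex has exactly two children -/
  card_children : ∀ v ∈ Finset.Icc (n + 2) (2 * n + 1), (children v).card = 2
  /-- the vertices `1, …, n + 1` are leaves -/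
  children_eq_empty : ∀ v, v ∉ Finset.Icc (n + 2) (2 * n + 1) → children v = ∅
  root_notMem_children : ∀ v, root ∉ children v
  existsUnique_parent : ∀ w ∈ Finset.Icc 1 (2 * n + 1), w ≠ root → ∃! v, w ∈ children v
  decreasing : ∀ v, ∀ w ∈ children v, w < v

namespace DecTree

variable {n : ℕ}

open Classical in
/-- The leaf set of the full subtree of `T` rooted at `v`. -/
noncomputable def leafSet (T : DecTree n) (v : ℕ) : Finset ℕ :=
  {a ∈ Finset.Icc 1 (n + 1) | Relation.ReflTransGen (fun u w => w ∈ T.children u) v a}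

/-- The restriction of `T` to the vertices with label at most `k`, as a graph
(all other numbers are isolated). -/
def restrict (T : DecTree n) (k : ℕ) : SimpleGraph ℕ :=
  SimpleGraph.fromRel fun v w => w ∈ T.children v ∧ v ≤ k ∧ w ≤ k

open Classical in
/-- The partition of `{1, …, n + 1}` whose blocks are the leaf sets of the connected components of
the restriction of `T` to the vertices with label at most `n + 1 + i`. -/
noncomputable def partitionAt (T : DecTree n) (i : ℕ) : PartitionLattice n :=
  Finpartition.ofSetSetoid (T.restrict (n + 1 + i)).reachableSetoid (Finset.Icc 1 (n + 1))

/-- The sequence of partitions `x₀, x₁, …, x_n` attached to `T`. -/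
noncomputable def chainList (T : DecTree n) : List (PartitionLattice n) :=
  (List.range (n + 1)).map T.partitionAt

/-- For an internal vertex `v`, the maximum of the two minima of the leaf sets of the full subtrees
rooted at the children of `v`. -/
noncomputable def vertexLabel (T : DecTree n) (v : ℕ) : ℕ :=
  (T.children v).sup fun w => sInf (T.leafSet w : Set ℕ)

/-- `S` is obtained from `T` by swapping the vertex labels `u` and `w`. -/
def IsLabelSwap (u w : ℕ) (T S : DecTree n) : Prop :=
  S.root = Equiv.swap u w T.root ∧
    ∀ v, S.children (Equiv.swap u w v) = (T.children v).image (Equiv.swap u w)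

/-- `u` is a child of `w` in `T`, and `S` is obtained from `T` by swapping the full subtree rooted
at the child `b ≠ u` of `w` with the full subtree rooted at a child `a` of `u`. -/
def IsSubtreeSwap (u w : ℕ) (T S : DecTree n) : Prop :=
  u ∈ T.children w ∧ ∃ b ∈ T.children w, b ≠ u ∧ ∃ a ∈ T.children u,
    S.root = T.root ∧
    S.children w = insert a ((T.children w).erase b) ∧
    S.children u = insert b ((T.children u).erase a) ∧
    ∀ v, v ≠ u → v ≠ w → S.children v = T.children v

/-- The moves `T ⇀ S`: for some consecutive internal labels `n + 1 + i` and `n + 1 + i + 1`, the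
tree `S` is obtained from `T` by a label swap or a subtree swap, and the vertex label of
`n + 1 + i` in `T` is smaller than that of `n + 1 + i + 1`. -/
def Move (T S : DecTree n) : Prop :=
  ∃ i, 1 ≤ i ∧ i + 1 ≤ n ∧
    (IsLabelSwap (n + 1 + i) (n + 1 + i + 1) T S ∨
      IsSubtreeSwap (n + 1 + i) (n + 1 + i + 1) T S) ∧
    T.vertexLabel (n + 1 + i) < T.vertexLabel (n + 1 + i + 1)

/-- The reflexive transitive closure of the moves. -/
def TreeLE : DecTree n → DecTree n → Prop :=
  Relation.ReflTransGen Move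

end DecTree

end ChainDescent

/-! Everything rests on the set `minSet x` of block minima. A cover `x ⋖ y` merges two blocks and
erases one element of it, the larger of the two minima, which is precisely the max-min label. Hence
the labels of any saturated chain from `x` to `y` are the elements of `minSet x \ minSet y`, each
occurring once (`IsSaturatedChain.labelSeq_spec`). An ascending chain must start with the least of
them, and only one cover of `x` below `y` has that label (`existsUnique_covBy_of_isLeast`), so the
EL-property follows by induction.

All maximal chains have the same length, so a polygon move replaces a single element and turns
adjacent labels `a < b` into `b, a`. The number of inversions rises by exactly one
(`inversions_of_polygonMove`). A relation that raises a rank by one generates a partial order whose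
covers are the relation itself (`coversIn_reflTransGen_iff`).

On the tree side, the blocks of the partition of index `i` are the leaf sets of the roots of the
forest on labels at most `n + 1 + i`. The next vertex creates its own leaf set as a block and
destroys those of its children. Since the tree is full, leaf sets determine descendants, so the
chain determines the tree; conversely, the blocks created and destroyed along any maximal chain
define a tree (`treeOfChain`).

Finally, let two chains differ at one index only. If the two merges around it involve disjoint pairs
of blocks, they are done in the other order: a label swap. If they join three blocks into one,
another pair is merged first: a subtree swap. So moves and polygon moves correspond
(`move_iff_polygonMove`), and the order, its antisymmetry and its covers transfer along the
bijection. -/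

namespace ChainDescent

open Finset

/-! ### Covers in lattices of partitions -/

section Partition

/-- The minimum of a finite set of natural numbers. -/
noncomputable def blockMin (B : Finset ℕ) : ℕ := sInf (B : Set ℕ)

lemma blockMin_mem {B : Finset ℕ} (h : B.Nonempty) : blockMin B ∈ B := by
  have := Nat.sInf_mem (s := (B : Set ℕ)) (by simpa using h)
  simpa [blockMin] using this

lemma blockMin_le {B : Finset ℕ} {a : ℕ} (h : a ∈ B) : blockMin B ≤ a :=
  Nat.sInf_le (by simpa using h)

variable {s : Finset ℕ} {x y z : Finpartition s} {A B C : Finset ℕ}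

lemma part_eq (hA : A ∈ x.parts) (hB : B ∈ x.parts) {a : ℕ} (ha : a ∈ A) (hb : a ∈ B) : A = B :=
  x.eq_of_mem_parts hA hB ha hb

lemma blockMin_mem_part (hA : A ∈ x.parts) : blockMin A ∈ A :=
  blockMin_mem (x.nonempty_of_mem_parts hA)

lemma blockMin_injOn : Set.InjOn blockMin (x.parts : Set (Finset ℕ)) := fun _ hA _ hB h =>
  part_eq hA hB (blockMin_mem_part hA) (h ▸ blockMin_mem_part hB)

/-- In a refinement, a block meeting a coarser block is contained in it. -/
lemma subset_of_le (hxy : x ≤ y) (hA : A ∈ x.parts) (hC : C ∈ y.parts) {a : ℕ} (ha : a ∈ A)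
    (hc : a ∈ C) : A ⊆ C := by
  obtain ⟨D, hD, hAD⟩ := hxy hA
  rwa [← part_eq hD hC (hAD ha) hc]

/-- A common block of two comparable partitions is a block of all partitions between them. -/
lemma mem_parts_of_le_of_le (hxy : x ≤ y) (hyz : y ≤ z) (hx : B ∈ x.parts) (hz : B ∈ z.parts) :
    B ∈ y.parts := by
  obtain ⟨D, hD, hBD⟩ := hxy hx
  have hDB := subset_of_le hyz hD hz (hBD (blockMin_mem_part hx)) (blockMin_mem_part hx)
  rwa [subset_antisymm hBD hDB]

/-- The partition obtained by merging two blocks. -/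
def merge (x : Finpartition s) (hA : A ∈ x.parts) (hB : B ∈ x.parts) : Finpartition s :=
  Finpartition.ofExistsUnique (insert (A ∪ B) ((x.parts.erase A).erase B))
    (by
      intro p hp
      rcases mem_insert.1 hp with rfl | hp
      · exact union_subset (x.subset hA) (x.subset hB)
      · exact x.subset (mem_of_mem_erase (mem_of_mem_erase hp)))
    (by
      intro a ha
      obtain ⟨D, hD, haD⟩ := x.exists_mem ha
      by_cases h : a ∈ A ∪ B
      · refine ⟨A ∪ B, ⟨mem_insert_self _ _, h⟩, ?_⟩
        rintro E ⟨hE, haE⟩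
        rcases mem_insert.1 hE with rfl | hE
        · rfl
        · simp only [mem_erase] at hE
          rcases mem_union.1 h with h | h
          · exact absurd (part_eq hE.2.2 hA haE h) hE.2.1
          · exact absurd (part_eq hE.2.2 hB haE h) hE.1
      · rw [mem_union, not_or] at h
        refine ⟨D, ⟨mem_insert_of_mem ?_, haD⟩, ?_⟩
        · simp only [mem_erase]
          exact ⟨fun e => h.2 (e ▸ haD), fun e => h.1 (e ▸ haD), hD⟩
        · rintro E ⟨hE, haE⟩
          rcases mem_insert.1 hE with rfl | hE
          · simp [h] at haE
          · simp only [mem_erase] at hE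
            exact part_eq hE.2.2 hD haE haD)
    (by
      intro h
      rcases mem_insert.1 h with h | h
      · have := x.nonempty_of_mem_parts hA
        rw [eq_comm, union_eq_empty] at h
        simp [h.1] at this
      · exact x.empty_notMem_parts (mem_of_mem_erase (mem_of_mem_erase h)))

lemma parts_merge (hA : A ∈ x.parts) (hB : B ∈ x.parts) :
    (merge x hA hB).parts = insert (A ∪ B) ((x.parts.erase A).erase B) := rfl

lemma le_merge (hA : A ∈ x.parts) (hB : B ∈ x.parts) : x ≤ merge x hA hB := by
  intro D hD
  simp only [parts_merge, mem_insert, mem_erase]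
  by_cases h1 : D = A
  · exact ⟨_, Or.inl rfl, h1 ▸ subset_union_left⟩
  by_cases h2 : D = B
  · exact ⟨_, Or.inl rfl, h2 ▸ subset_union_right⟩
  exact ⟨D, Or.inr ⟨h2, h1, hD⟩, le_rfl⟩

lemma merge_le (hA : A ∈ x.parts) (hB : B ∈ x.parts) (hxz : x ≤ z) (hC : C ∈ z.parts)
    (hAC : A ⊆ C) (hBC : B ⊆ C) : merge x hA hB ≤ z := by
  intro D hD
  rcases mem_insert.1 hD with rfl | hD
  · exact ⟨C, hC, union_subset hAC hBC⟩
  · exact hxz (mem_of_mem_erase (mem_of_mem_erase hD))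

lemma union_notMem_parts (hA : A ∈ x.parts) (hB : B ∈ x.parts) (hAB : A ≠ B) :
    A ∪ B ∉ x.parts := fun h =>
  hAB ((part_eq hA h (blockMin_mem_part hA) (subset_union_left (blockMin_mem_part hA))).trans
    (part_eq hB h (blockMin_mem_part hB) (subset_union_right (blockMin_mem_part hB))).symm)

lemma lt_merge (hA : A ∈ x.parts) (hB : B ∈ x.parts) (hAB : A ≠ B) : x < merge x hA hB := by
  refine lt_of_le_of_ne (le_merge hA hB) fun h => union_notMem_parts hA hB hAB ?_
  have : A ∪ B ∈ (merge x hA hB).parts := mem_insert_self _ _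
  rwa [← h] at this

/-- If each block of `y` contained only one block of `x`, that block would fill it, giving `y ≤ x`.
-/
lemma exists_ne_of_lt (hxy : x < y) :
    ∃ A ∈ x.parts, ∃ B ∈ x.parts, A ≠ B ∧ ∃ C ∈ y.parts, A ⊆ C ∧ B ⊆ C := by
  by_contra! H
  refine hxy.not_ge fun C hC => ?_
  have hCs := blockMin_mem_part hC
  obtain ⟨A, hA, hmA⟩ := x.exists_mem (y.subset hC hCs)
  have hAC := subset_of_le hxy.le hA hC hmA hCs
  refine ⟨A, hA, fun b hb => ?_⟩
  obtain ⟨B, hB, hbB⟩ := x.exists_mem (y.subset hC hb)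
  by_cases h : A = B
  · exact h ▸ hbB
  · exact absurd (subset_of_le hxy.le hB hC hbB hb) (H A hA B hB h C hC hAC)

/-- Anything strictly above `x` joins two blocks of `x`; below the merge these can only be `A` and
`B`. -/
lemma covBy_merge (hA : A ∈ x.parts) (hB : B ∈ x.parts) (hAB : A ≠ B) : x ⋖ merge x hA hB := by
  refine ⟨lt_merge hA hB hAB, fun z hxz hz => hz.not_ge ?_⟩
  obtain ⟨A', hA', B', hB', hne, C, hC, hAC, hBC⟩ := exists_ne_of_lt hxz
  obtain ⟨D, hD, hCD⟩ := hz.le hC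
  rcases mem_insert.1 hD with rfl | hD
  · have key : ∀ E ∈ x.parts, E ⊆ C → E = A ∨ E = B := fun E hE hEC => by
      have hm := blockMin_mem_part hE
      rcases mem_union.1 (hCD (hEC hm)) with h | h
      · exact Or.inl (part_eq hE hA hm h)
      · exact Or.inr (part_eq hE hB hm h)
    have hAC' : A ⊆ C ∧ B ⊆ C := by
      rcases key A' hA' hAC with rfl | rfl <;> rcases key B' hB' hBC with rfl | rfl
      · exact absurd rfl hne
      · exact ⟨hAC, hBC⟩
      · exact ⟨hBC, hAC⟩
      · exact absurd rfl hne
    exact merge_le hA hB hxz.le hC hAC'.1 hAC'.2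
  · have hDx := mem_of_mem_erase (mem_of_mem_erase hD)
    have e1 := part_eq hA' hDx (blockMin_mem_part hA') (hCD (hAC (blockMin_mem_part hA')))
    have e2 := part_eq hB' hDx (blockMin_mem_part hB') (hCD (hBC (blockMin_mem_part hB')))
    exact absurd (e1.trans e2.symm) hne

lemma covBy_of_parts_eq (hA : A ∈ x.parts) (hB : B ∈ x.parts) (hAB : A ≠ B)
    (hy : y.parts = insert (A ∪ B) ((x.parts.erase A).erase B)) : x ⋖ y := by
  have : y = merge x hA hB := Finpartition.ext hy
  exact this ▸ covBy_merge hA hB hAB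

/-- A cover relation merges two blocks `A` and `B`. -/
lemma exists_of_covBy (h : x ⋖ y) : ∃ A ∈ x.parts, ∃ B ∈ x.parts, blockMin A < blockMin B ∧
    y.parts = insert (A ∪ B) ((x.parts.erase A).erase B) := by
  obtain ⟨A, hA, B, hB, hne, C, hC, hAC, hBC⟩ := exists_ne_of_lt h.lt
  have hy : merge x hA hB = y := by
    by_contra hy
    exact h.2 (lt_merge hA hB hne) (lt_of_le_of_ne (merge_le hA hB h.le hC hAC hBC) hy)
  rcases lt_trichotomy (blockMin A) (blockMin B) with hlt | heq | hlt
  · exact ⟨A, hA, B, hB, hlt, hy ▸ rfl⟩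
  · exact absurd (blockMin_injOn hA hB heq) hne
  · exact ⟨B, hB, A, hA, hlt, by rw [← hy, parts_merge, union_comm, erase_right_comm]⟩

lemma sdiff_of_parts_eq (hA : A ∈ x.parts) (hB : B ∈ x.parts) (hAB : A ≠ B)
    (hy : y.parts = insert (A ∪ B) ((x.parts.erase A).erase B)) :
    x.parts \ y.parts = {A, B} ∧ y.parts \ x.parts = {A ∪ B} := by
  have hu := union_notMem_parts hA hB hAB
  constructor
  · ext D
    simp only [hy, mem_sdiff, mem_insert, mem_erase, mem_singleton]
    constructor
    · tauto
    · rintro (rfl | rfl)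
      · exact ⟨hA, by rintro (h | h); exacts [hu (h ▸ hA), h.2.1 rfl]⟩
      · exact ⟨hB, by rintro (h | h); exacts [hu (h ▸ hB), h.1 rfl]⟩
  · ext D
    simp only [hy, mem_sdiff, mem_insert, mem_erase, mem_singleton]
    constructor
    · tauto
    · rintro rfl
      exact ⟨Or.inl rfl, hu⟩

lemma sdiff_of_covBy (h : x ⋖ y) : ∃ A ∈ x.parts, ∃ B ∈ x.parts, blockMin A < blockMin B ∧
    y.parts = insert (A ∪ B) ((x.parts.erase A).erase B) ∧
    x.parts \ y.parts = {A, B} ∧ y.parts \ x.parts = {A ∪ B} := by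
  obtain ⟨A, hA, B, hB, hlt, hy⟩ := exists_of_covBy h
  exact ⟨A, hA, B, hB, hlt, hy, sdiff_of_parts_eq hA hB (by rintro rfl; exact hlt.false) hy⟩

/-! ### Block minima and the max-min labeling -/

/-- The set of minima of the blocks of a partition. -/
noncomputable def minSet (x : Finpartition s) : Finset ℕ := x.parts.image blockMin

lemma blockMin_mem_minSet (hA : A ∈ x.parts) : blockMin A ∈ minSet x := mem_image_of_mem _ hA

lemma card_minSet (x : Finpartition s) : (minSet x).card = x.parts.card :=
  card_image_of_injOn blockMin_injOn

/-- The minimum of a coarse block is also the minimum of the fine block that contains it. -/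
lemma minSet_subset_of_le (h : x ≤ y) : minSet y ⊆ minSet x := by
  intro a ha
  obtain ⟨C, hC, rfl⟩ := mem_image.1 ha
  have hm := blockMin_mem_part hC
  obtain ⟨A, hA, hmA⟩ := x.exists_mem (y.subset hC hm)
  have hAC := subset_of_le h hA hC hmA hm
  have : blockMin A = blockMin C :=
    le_antisymm (blockMin_le hmA) (blockMin_le (hAC (blockMin_mem_part hA)))
  exact this ▸ blockMin_mem_minSet hA

/-- Two fine blocks inside one coarse block cannot both keep their minima as minima of coarse
blocks. -/
lemma eq_of_le_of_minSet_eq (h : x ≤ y) (he : minSet x = minSet y) : x = y := by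
  by_contra hne
  obtain ⟨A, hA, B, hB, hAB, C, hC, hAC, hBC⟩ := exists_ne_of_lt (lt_of_le_of_ne h hne)
  have key : ∀ D ∈ x.parts, D ⊆ C → blockMin D = blockMin C := fun D hD hDC => by
    have : blockMin D ∈ minSet y := he ▸ blockMin_mem_minSet hD
    obtain ⟨E, hE, hED⟩ := mem_image.1 this
    have hm := blockMin_mem_part hE
    rw [← part_eq hE hC (hED ▸ hm) (hDC (blockMin_mem_part hD)), hED]
  exact hAB (blockMin_injOn hA hB ((key A hA hAC).trans (key B hB hBC).symm))

lemma blockMin_union (hA : A.Nonempty) (h : blockMin A < blockMin B) :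
    blockMin (A ∪ B) = blockMin A := by
  refine le_antisymm (blockMin_le (mem_union_left _ (blockMin_mem hA))) ?_
  rcases mem_union.1 (blockMin_mem (hA.mono (subset_union_left (s₂ := B)))) with h' | h'
  · exact blockMin_le h'
  · exact h.le.trans (blockMin_le h')

end Partition

section Label

variable {n : ℕ} {x y z : PartitionLattice n} {A B : Finset ℕ}

lemma maxMinLabel_eq (hA : A ∈ x.parts) (hB : B ∈ x.parts) (hAB : blockMin A < blockMin B)
    (hy : y.parts = insert (A ∪ B) ((x.parts.erase A).erase B)) :
    maxMinLabel n x y = blockMin B := by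
  have := (sdiff_of_parts_eq hA hB (by rintro rfl; exact hAB.false) hy).1
  rw [maxMinLabel, this, sup_insert, sup_singleton]
  exact max_eq_right hAB.le

lemma minSet_of_parts_eq (hA : A ∈ x.parts) (hB : B ∈ x.parts) (hAB : blockMin A < blockMin B)
    (hy : y.parts = insert (A ∪ B) ((x.parts.erase A).erase B)) :
    minSet y = (minSet x).erase (blockMin B) := by
  ext a
  simp only [minSet, hy, mem_image, mem_insert, mem_erase]
  constructor
  · rintro ⟨D, rfl | ⟨h1, h2, h3⟩, rfl⟩
    · rw [blockMin_union (x.nonempty_of_mem_parts hA) hAB]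
      exact ⟨hAB.ne, A, hA, rfl⟩
    · exact ⟨fun h => h1 (blockMin_injOn h3 hB h), D, h3, rfl⟩
  · rintro ⟨h, D, hD, rfl⟩
    by_cases hDA : D = A
    · exact ⟨_, Or.inl rfl, by rw [blockMin_union (x.nonempty_of_mem_parts hA) hAB, hDA]⟩
    · exact ⟨D, Or.inr ⟨fun e => h (e ▸ rfl), hDA, hD⟩, rfl⟩

lemma minSet_of_covBy (h : x ⋖ y) : minSet y = (minSet x).erase (maxMinLabel n x y) := by
  obtain ⟨A, hA, B, hB, hlt, hy⟩ := exists_of_covBy h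
  rw [maxMinLabel_eq hA hB hlt hy, minSet_of_parts_eq hA hB hlt hy]

lemma maxMinLabel_mem_minSet (h : x ⋖ y) : maxMinLabel n x y ∈ minSet x := by
  obtain ⟨A, hA, B, hB, hlt, hy⟩ := exists_of_covBy h
  rw [maxMinLabel_eq hA hB hlt hy]
  exact blockMin_mem_minSet hB

lemma maxMinLabel_mem_sdiff (h : x ⋖ y) (hyz : y ≤ z) :
    maxMinLabel n x y ∈ minSet x \ minSet z := by
  refine mem_sdiff.2 ⟨maxMinLabel_mem_minSet h, fun h' => ?_⟩
  have := minSet_subset_of_le hyz h'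
  simp [minSet_of_covBy h] at this

/-- In `[x, z]` there is a unique cover of `x` with the smallest possible label. -/
lemma existsUnique_covBy_of_isLeast (hxz : x ≤ z) {a : ℕ} (ha : a ∈ minSet x \ minSet z)
    (hmin : ∀ b ∈ minSet x \ minSet z, a ≤ b) :
    ∃! y, x ⋖ y ∧ y ≤ z ∧ maxMinLabel n x y = a := by
  obtain ⟨hax, haz⟩ := mem_sdiff.1 ha
  obtain ⟨B, hB, rfl⟩ := mem_image.1 hax
  obtain ⟨C, hC, hBC⟩ := hxz hB
  have hmC := blockMin_mem_part hC
  -- The partner of `B` has to be the block that holds the minimum of the surrounding block `C` of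
  -- `z`.
  obtain ⟨A, hA, hmA⟩ := x.exists_mem (z.subset hC hmC)
  have hAC := subset_of_le hxz hA hC hmA hmC
  have hAm : blockMin A = blockMin C :=
    le_antisymm (blockMin_le hmA) (blockMin_le (hAC (blockMin_mem_part hA)))
  have hlt : blockMin A < blockMin B := by
    rw [hAm]
    refine lt_of_le_of_ne (blockMin_le (hBC (blockMin_mem_part hB))) fun h => haz ?_
    exact h ▸ blockMin_mem_minSet hC
  have hne : A ≠ B := by rintro rfl; exact hlt.false
  refine ⟨merge x hA hB, ⟨covBy_merge hA hB hne, merge_le hA hB hxz hC hAC hBC,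
    maxMinLabel_eq hA hB hlt rfl⟩, ?_⟩
  rintro y ⟨hxy, hyz, hlab⟩
  obtain ⟨A', hA', B', hB', hlt', hy⟩ := exists_of_covBy hxy
  rw [maxMinLabel_eq hA' hB' hlt' hy] at hlab
  obtain rfl := blockMin_injOn hB' hB hlab
  have hU : A' ∪ B' ∈ y.parts := hy ▸ mem_insert_self _ _
  have hUC : A' ∪ B' ⊆ C := subset_of_le hyz hU hC
    (subset_union_right (blockMin_mem_part hB)) (hBC (blockMin_mem_part hB))
  -- `blockMin A'` is smaller than every minimum that gets lost, so it survives in `z`. The block of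
  -- `z` carrying it is `C`, which forces `A' = A`.
  have hA'z : blockMin A' ∈ minSet z := by
    by_contra h
    exact hlt'.not_ge (hmin _ (mem_sdiff.2 ⟨blockMin_mem_minSet hA', h⟩))
  obtain ⟨E, hE, hEA⟩ := mem_image.1 hA'z
  have hEC : E = C := part_eq hE hC (hEA ▸ blockMin_mem_part hE)
    (hUC (subset_union_left (blockMin_mem_part hA')))
  have hAA : A' = A := blockMin_injOn hA' hA (by rw [hAm, ← hEA, hEC])
  subst hAA
  exact Finpartition.ext hy

end Label

/-! ### Saturated chains and their label sequences -/

section LabelSeq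

variable {P L : Type*} {lam : P → P → L} {x y : P} {l p r : List P}

@[simp] lemma labelSeq_singleton : labelSeq lam [x] = [] := rfl

@[simp] lemma labelSeq_cons_cons :
    labelSeq lam (x :: y :: l) = lam x y :: labelSeq lam (y :: l) := rfl

lemma labelSeq_append_cons : labelSeq lam (p ++ x :: r) =
    labelSeq lam (p ++ [x]) ++ labelSeq lam (x :: r) := by
  induction p with
  | nil => rfl
  | cons a p ih => cases p with
    | nil => rfl
    | cons b p => simpa using ih

end LabelSeq

section Chain

variable {P : Type*} [PartialOrder P] {x y z : P} {l : List P}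

lemma isSaturatedChain_cons_cons :
    IsSaturatedChain x z (x :: y :: l) ↔ x ⋖ y ∧ IsSaturatedChain y z (y :: l) := by
  simp [IsSaturatedChain, and_assoc]

lemma IsSaturatedChain.eq_cons (h : IsSaturatedChain x y l) : ∃ l', l = x :: l' := by
  obtain ⟨-, h, -⟩ := h
  cases l with
  | nil => simp at h
  | cons a l' => exact ⟨l', by simpa using h⟩

lemma IsSaturatedChain.le (h : IsSaturatedChain x y l) : x ≤ y := by
  induction l generalizing x with
  | nil => simp [IsSaturatedChain] at h
  | cons a l ih =>
    obtain ⟨l', hl'⟩ := h.eq_cons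
    obtain ⟨rfl, rfl⟩ := List.cons.inj hl'
    cases l with
    | nil =>
      obtain rfl : a = y := by simpa [IsSaturatedChain] using h
      exact le_rfl
    | cons b l =>
      obtain ⟨h1, h2⟩ := isSaturatedChain_cons_cons.1 h
      exact h1.le.trans (ih h2)

lemma IsSaturatedChain.eq_singleton (h : IsSaturatedChain x x l) : l = [x] := by
  obtain ⟨l', rfl⟩ := h.eq_cons
  cases l' with
  | nil => rfl
  | cons b l =>
    obtain ⟨h1, h2⟩ := isSaturatedChain_cons_cons.1 h
    exact absurd h2.le h1.lt.not_ge

lemma isSaturatedChain_singleton (x : P) : IsSaturatedChain x x [x] := by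
  simp [IsSaturatedChain]

/-- A saturated chain between distinct elements starts with a cover relation. -/
lemma IsSaturatedChain.exists_cons_cons (h : IsSaturatedChain x y l) (hne : x ≠ y) :
    ∃ a l', l = x :: a :: l' ∧ x ⋖ a ∧ IsSaturatedChain a y (a :: l') := by
  obtain ⟨l', rfl⟩ := h.eq_cons
  cases l' with
  | nil => simp [IsSaturatedChain, hne] at h
  | cons a l' => exact ⟨a, l', rfl, isSaturatedChain_cons_cons.1 h⟩

end Chain

/-! ### Label sets of saturated chains and the EL-property -/

section Label

variable {n : ℕ} {x y : PartitionLattice n} {l : List (PartitionLattice n)}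

/-- Each cover erases its label from the set of minima, and an erased minimum never returns. -/
lemma IsSaturatedChain.labelSeq_spec (h : IsSaturatedChain x y l) :
    (labelSeq (maxMinLabel n) l).Nodup ∧
      ∀ a, a ∈ labelSeq (maxMinLabel n) l ↔ a ∈ minSet x \ minSet y := by
  induction l generalizing x with
  | nil => simp [IsSaturatedChain] at h
  | cons b l ih =>
    by_cases hne : x = y
    · subst hne
      rw [h.eq_singleton]
      simp
    · obtain ⟨c, l', hl, hxc, hc⟩ := h.exists_cons_cons hne
      obtain ⟨rfl, rfl⟩ := List.cons.inj hl
      obtain ⟨ih1, ih2⟩ := ih hc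
      have hM := minSet_of_covBy hxc
      have hmem := mem_sdiff.1 (maxMinLabel_mem_sdiff hxc hc.le)
      rw [labelSeq_cons_cons, List.nodup_cons]
      refine ⟨⟨?_, ih1⟩, fun a => ?_⟩
      · rw [ih2, hM]
        simp
      · rw [List.mem_cons, ih2, hM]
        simp only [mem_sdiff, mem_erase]
        constructor
        · rintro (rfl | h')
          · exact hmem
          · exact ⟨h'.1.2, h'.2⟩
        · rintro ⟨h1, h2⟩
          by_cases ha : a = maxMinLabel n b c
          · exact Or.inl ha
          · exact Or.inr ⟨⟨ha, h1⟩, h2⟩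

lemma length_of_isSaturatedChain (h : IsSaturatedChain x y l) :
    l.length + (minSet y).card = (minSet x).card + 1 := by
  have h1 := h.labelSeq_spec
  have h2 : (labelSeq (maxMinLabel n) l).toFinset = minSet x \ minSet y := by
    ext a; rw [List.mem_toFinset, h1.2]
  have h3 := List.toFinset_card_of_nodup h1.1
  obtain ⟨l', rfl⟩ := h.eq_cons
  have h4 := card_le_card (minSet_subset_of_le h.le)
  rw [h2, card_sdiff_of_subset (minSet_subset_of_le h.le)] at h3
  simp [labelSeq] at h3 ⊢
  omega

/-- All chains use the same labels, so an ascending one starts with the least, which only one cover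
offers. Any other chain starts with a larger label or differs only further up. The case `x = y` is
allowed so that the induction can end there. -/
lemma exists_isUniqueAscending (x y : PartitionLattice n) (hxy : x ≤ y) :
    ∃ l, IsUniqueAscending (maxMinLabel n) x y l ∧
      ∀ l', IsSaturatedChain x y l' → l' ≠ l →
        LexPrecedes (labelSeq (maxMinLabel n) l) (labelSeq (maxMinLabel n) l') := by
  induction hk : (minSet x).card generalizing x with
  | zero =>
    have h0 : minSet x = ∅ := card_eq_zero.1 hk
    have h1 : minSet y = ∅ := subset_empty.1 (h0 ▸ minSet_subset_of_le hxy)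
    obtain rfl := eq_of_le_of_minSet_eq hxy (h0.trans h1.symm)
    exact ⟨[x], ⟨isSaturatedChain_singleton x, by simp [IsAscending],
      fun l' h _ => h.eq_singleton⟩, fun l' h hne => absurd h.eq_singleton hne⟩
  | succ k ih =>
    by_cases hne : x = y
    · subst hne
      exact ⟨[x], ⟨isSaturatedChain_singleton x, by simp [IsAscending],
        fun l' h _ => h.eq_singleton⟩, fun l' h hne => absurd h.eq_singleton hne⟩
    have hnon : (minSet x \ minSet y).Nonempty := by
      rw [sdiff_nonempty]
      exact fun h => hne (eq_of_le_of_minSet_eq hxy (subset_antisymm h (minSet_subset_of_le hxy)))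
    obtain ⟨a, ha, hmin⟩ : ∃ a ∈ minSet x \ minSet y, ∀ b ∈ minSet x \ minSet y, a ≤ b :=
      ⟨_, min'_mem _ hnon, fun b hb => min'_le _ b hb⟩
    obtain ⟨c, ⟨hxc, hcy, hlab⟩, huniq⟩ := existsUnique_covBy_of_isLeast hxy ha hmin
    have hM := minSet_of_covBy hxc
    have hcard : (minSet c).card = k := by
      rw [hM, card_erase_of_mem (maxMinLabel_mem_minSet hxc), hk]
      rfl
    obtain ⟨l, ⟨hl, hasc, hlu⟩, hlex⟩ := ih c hcy hcard
    obtain ⟨l₀, rfl⟩ := hl.eq_cons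
    have hle : ∀ d l', x ⋖ d → IsSaturatedChain d y (d :: l') →
        a ≤ maxMinLabel n x d := fun d l' hd hs => hmin _ (maxMinLabel_mem_sdiff hd hs.le)
    refine ⟨x :: c :: l₀, ⟨isSaturatedChain_cons_cons.2 ⟨hxc, hl⟩, ?_, ?_⟩, ?_⟩
    · rw [IsAscending, labelSeq_cons_cons, List.isChain_cons]
      refine ⟨fun b hb => ?_, hasc⟩
      rw [hlab]
      refine hmin b ?_
      have := (hl.labelSeq_spec.2 b).1 (List.mem_of_mem_head? hb)
      rw [hM] at this
      simp only [mem_sdiff, mem_erase] at this ⊢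
      exact ⟨this.1.2, this.2⟩
    · intro l' hl' hasc'
      have hspec := hl'.labelSeq_spec
      obtain ⟨d, l₁, rfl, hxd, hd⟩ := hl'.exists_cons_cons hne
      have hda : maxMinLabel n x d = a := by
        refine le_antisymm ?_ (hle d l₁ hxd hd)
        have h1 := (hspec.2 a).2 ha
        rw [IsAscending, List.isChain_iff_pairwise] at hasc'
        rw [labelSeq_cons_cons] at hasc' h1
        rcases List.mem_cons.1 h1 with h1 | h1
        · exact h1.ge
        · exact (List.pairwise_cons.1 hasc').1 a h1
      obtain rfl := huniq d ⟨hxd, hd.le, hda⟩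
      rw [hlu _ hd (by rw [IsAscending, labelSeq_cons_cons] at hasc'; exact hasc'.tail)]
    · intro l' hl' hl'ne
      obtain ⟨d, l₁, rfl, hxd, hd⟩ := hl'.exists_cons_cons hne
      rw [labelSeq_cons_cons, labelSeq_cons_cons]
      by_cases hdc : d = c
      · subst hdc
        obtain ⟨p, s, t, u, v, huv, h1, h2⟩ := hlex _ hd fun h => hl'ne (by rw [h])
        exact ⟨maxMinLabel n x d :: p, s, t, u, v, huv, by rw [h1]; rfl, by rw [h2]; rfl⟩
      · refine ⟨[], _, _, _, _, ?_, rfl, rfl⟩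
        rw [hlab]
        exact lt_of_le_of_ne (hle d l₁ hxd hd) fun h => hdc (huniq d ⟨hxd, hd.le, h.symm⟩)

/-- The max-min labeling is an EL-labeling. -/
theorem isELLabeling_maxMinLabel (n : ℕ) : IsELLabeling (maxMinLabel n) :=
  fun x y h => exists_isUniqueAscending x y h.le

end Label

/-! ### Orders generated by a relation that raises a rank by one -/

section Rank

variable {α : Type*} {R : α → α → Prop} {f : α → ℕ}

lemma rank_le_of_reflTransGen (hf : ∀ a b, R a b → f b = f a + 1) {a b : α}
    (h : Relation.ReflTransGen R a b) : f a ≤ f b := by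
  induction h with
  | refl => exact le_rfl
  | tail _ h ih => rw [hf _ _ h]; omega

lemma eq_of_reflTransGen_of_rank_le (hf : ∀ a b, R a b → f b = f a + 1) {a b : α}
    (h : Relation.ReflTransGen R a b) (hab : f b ≤ f a) : a = b := by
  rcases Relation.ReflTransGen.cases_tail h with h' | ⟨c, hc, hcb⟩
  · exact h'.symm
  · have := rank_le_of_reflTransGen hf hc
    have := hf _ _ hcb
    omega

lemma isPartialOrder_reflTransGen (hf : ∀ a b, R a b → f b = f a + 1) :
    IsPartialOrder α (Relation.ReflTransGen R) where
  refl _ := Relation.ReflTransGen.refl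
  trans _ _ _ := Relation.ReflTransGen.trans
  antisymm _ _ h h' := eq_of_reflTransGen_of_rank_le hf h (rank_le_of_reflTransGen hf h')

/-- No rank fits strictly between those of `a` and `b`, so an intermediate element has the rank of
an endpoint and equals it. -/
lemma coversIn_reflTransGen_iff (hf : ∀ a b, R a b → f b = f a + 1) {a b : α} :
    CoversIn (Relation.ReflTransGen R) a b ↔ R a b := by
  constructor
  · rintro ⟨h, hne, hcov⟩
    rcases Relation.ReflTransGen.cases_head h with h' | ⟨c, hac, hcb⟩
    · exact absurd h' hne
    · rcases hcov c (.single hac) hcb with rfl | rfl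
      · have := hf _ _ hac
        omega
      · exact hac
  · intro h
    have hab := hf _ _ h
    refine ⟨.single h, by rintro rfl; omega, fun z haz hzb => ?_⟩
    by_cases hz : f z ≤ f a
    · exact Or.inl (eq_of_reflTransGen_of_rank_le hf haz hz).symm
    · exact Or.inr (eq_of_reflTransGen_of_rank_le hf hzb (by omega))

end Rank

/-! ### Polygon moves for the max-min labeling -/

/-- The number of inversions of a sequence. -/
def inversions : List ℕ → ℕ
  | [] => 0
  | a :: l => l.countP (· < a) + inversions l

/-- Only the swapped pair changes its relative order; the counts for earlier entries do not see the
order of later ones. -/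
lemma inversions_swap (p s : List ℕ) {a b : ℕ} (h : a < b) :
    inversions (p ++ b :: a :: s) = inversions (p ++ a :: b :: s) + 1 := by
  induction p with
  | nil =>
    simp [inversions, h, h.le]
    omega
  | cons c p ih =>
    simp only [List.cons_append, inversions, ih, List.countP_append, List.countP_cons]
    omega

section Polygon

variable {n : ℕ} {m m' : MaxChain (PartitionLattice n)}

lemma length_eq_of_maxChain : m.1.length = m'.1.length := by
  have h1 := length_of_isSaturatedChain m.2
  have h2 := length_of_isSaturatedChain m'.2
  omega

lemma isSaturatedChain_of_append {P : Type*} [PartialOrder P] {x y z a b : P} {p s : List P}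
    (h : IsSaturatedChain a b (p ++ [x, y, z] ++ s)) : IsSaturatedChain x z [x, y, z] := by
  have := h.1.left_of_append.right_of_append
  exact ⟨this, rfl, rfl⟩

/-- Both pairs of labels list `minSet x \ minSet z` without repetition, so they agree up to order.
-/
lemma isSaturatedChain_three_labels {x y y' z : PartitionLattice n}
    (h : IsSaturatedChain x z [x, y, z]) (h' : IsSaturatedChain x z [x, y', z]) :
    (maxMinLabel n x y = maxMinLabel n x y' ∧ maxMinLabel n y z = maxMinLabel n y' z) ∨
    (maxMinLabel n x y = maxMinLabel n y' z ∧ maxMinLabel n y z = maxMinLabel n x y') := by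
  have h1 := h.labelSeq_spec
  have h2 := h'.labelSeq_spec
  have h3 : ∀ a, a ∈ labelSeq (maxMinLabel n) [x, y, z] ↔
    a ∈ labelSeq (maxMinLabel n) [x, y', z] := fun a => by rw [h1.2, h2.2]
  have h1 := h1.1
  have h2 := h2.1
  simp only [labelSeq_cons_cons, labelSeq_singleton, List.nodup_cons, List.mem_cons,
    List.not_mem_nil, or_false, not_false_eq_true, List.nodup_nil, and_true] at h1 h2 h3
  have h4 := (h3 (maxMinLabel n x y)).1 (Or.inl rfl)
  have h5 := (h3 (maxMinLabel n y z)).1 (Or.inr rfl)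
  rcases h4 with h4 | h4 <;> rcases h5 with h5 | h5
  · exact absurd (h4.trans h5.symm) h1
  · exact Or.inl ⟨h4, h5⟩
  · exact Or.inr ⟨h4, h5⟩
  · exact absurd (h4.trans h5.symm) h1

lemma isAscending_three {x y z : PartitionLattice n} :
    IsAscending (maxMinLabel n) [x, y, z] ↔ maxMinLabel n x y ≤ maxMinLabel n y z := by
  simp [IsAscending]

/-- A polygon move replaces one element of a chain at which the labels ascend. -/
lemma polygonMove_iff : PolygonMove (maxMinLabel n) m m' ↔
    ∃ (p s : List (PartitionLattice n)) (x y y' z : PartitionLattice n),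
      m.1 = p ++ [x, y, z] ++ s ∧ m'.1 = p ++ [x, y', z] ++ s ∧ y ≠ y' ∧
      maxMinLabel n x y < maxMinLabel n y z := by
  constructor
  · rintro ⟨p, q, s, x, y', z, hm, hm', hy', ⟨hsat, hasc, -⟩, -⟩
    -- All maximal chains have equal length, so the ascending chain also has exactly one interior
    -- element.
    have hlen : q.length = 1 := by
      have := length_eq_of_maxChain (m := m) (m' := m')
      rw [hm, hm'] at this
      simp at this
      omega
    obtain ⟨y, rfl⟩ := List.length_eq_one_iff.1 hlen
    refine ⟨p, s, x, y, y', z, hm, hm', ?_, lt_of_le_of_ne (isAscending_three.1 hasc) ?_⟩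
    · rintro rfl
      exact hy' (by simp [hm])
    · simpa using hsat.labelSeq_spec.1
  · rintro ⟨p, s, x, y, y', z, hm, hm', hne, hlt⟩
    have hs := isSaturatedChain_of_append (hm ▸ m.2)
    have hs' := isSaturatedChain_of_append (hm' ▸ m'.2)
    obtain ⟨l, ⟨hl1, hl2, hl3⟩, -⟩ := isELLabeling_maxMinLabel n x z
      ((isSaturatedChain_cons_cons.1 hs).1.lt.trans_le (isSaturatedChain_cons_cons.1 hs).2.le)
    obtain rfl := hl3 _ hs (isAscending_three.2 hlt.le)
    refine ⟨p, [y], s, x, y', z, hm, hm', ?_, ⟨hl1, hl2, hl3⟩, fun hle => ?_⟩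
    -- As `x < y' < z`, the increasing chain `m` could contain `y'` only between `x` and `z`, where
    -- it has only `y`.
    · have hxy' := (isSaturatedChain_cons_cons.1 hs').1.lt
      have hyz' := (isSaturatedChain_cons_cons.1 (isSaturatedChain_cons_cons.1 hs').2).1.lt
      have hp : m.1.Pairwise (· < ·) :=
        List.isChain_iff_pairwise.1 (m.2.1.imp fun _ _ h => h.lt)
      rw [hm] at hp ⊢
      simp only [List.append_assoc, List.pairwise_append, List.cons_append, List.nil_append,
        List.pairwise_cons, List.mem_cons, List.mem_append] at hp ⊢
      rintro (h | rfl | rfl | rfl | h)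
      · exact (hp.2.2 y' h x (Or.inl rfl)).not_gt hxy'
      · exact hxy'.false
      · exact hne rfl
      · exact hyz'.false
      · exact (hp.2.1.2.2.1 y' h).not_gt hyz'
    · have := hl3 _ hs' (isAscending_three.2 hle)
      simp only [List.cons.injEq, and_true, true_and] at this
      exact hne this.symm

/-- The two labels are interchanged: were they kept, the new chain would ascend too, against
uniqueness. -/
lemma inversions_of_polygonMove (h : PolygonMove (maxMinLabel n) m m') :
    inversions (labelSeq (maxMinLabel n) m'.1) =
      inversions (labelSeq (maxMinLabel n) m.1) + 1 := by
  obtain ⟨p, s, x, y, y', z, hm, hm', hne, hlt⟩ := polygonMove_iff.1 h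
  have hs := isSaturatedChain_of_append (hm ▸ m.2)
  have hs' := isSaturatedChain_of_append (hm' ▸ m'.2)
  have hlab := isSaturatedChain_three_labels hs hs'
  have hdesc : ¬ maxMinLabel n x y' ≤ maxMinLabel n y' z := fun hle => by
    obtain ⟨l, ⟨-, -, hl⟩, -⟩ := isELLabeling_maxMinLabel n x z
      ((isSaturatedChain_cons_cons.1 hs).1.lt.trans_le (isSaturatedChain_cons_cons.1 hs).2.le)
    have := (hl _ hs (isAscending_three.2 hlt.le)).trans (hl _ hs' (isAscending_three.2 hle)).symm
    simp only [List.cons.injEq, and_true, true_and] at this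
    exact hne this
  rw [hm, hm']
  simp only [List.append_assoc, List.cons_append, List.nil_append]
  rw [labelSeq_append_cons, labelSeq_append_cons (r := y :: z :: s)]
  simp only [labelSeq_cons_cons]
  rcases hlab with ⟨h1, h2⟩ | ⟨h1, h2⟩
  · omega
  · rw [← h1, ← h2, inversions_swap _ _ hlt]

theorem isPartialOrder_descentLE (n : ℕ) :
    IsPartialOrder (MaxChain (PartitionLattice n)) (DescentLE (maxMinLabel n)) :=
  isPartialOrder_reflTransGen fun _ _ h => inversions_of_polygonMove h

end Polygon

namespace DecTree

variable {n : ℕ} {T S : DecTree n} {v w a b c r k i : ℕ}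

/-! ### Descendants -/

/-- `a` is a (weak) descendant of `v`. -/
def Desc (T : DecTree n) : ℕ → ℕ → Prop :=
  Relation.ReflTransGen fun u w => w ∈ T.children u

/-- The set of vertices. -/
abbrev verts (n : ℕ) : Finset ℕ := Icc 1 (2 * n + 1)

lemma mem_Icc_of_mem_children (h : w ∈ T.children v) : v ∈ Icc (n + 2) (2 * n + 1) := by
  by_contra hv
  simp [T.children_eq_empty v hv] at h

lemma mem_verts_of_mem_children (h : w ∈ T.children v) : v ∈ verts n := by
  have := mem_Icc.1 (mem_Icc_of_mem_children h)
  exact mem_Icc.2 ⟨by omega, this.2⟩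

lemma parent_unique (h : w ∈ T.children v) (h' : w ∈ T.children a) : v = a := by
  have hw : w ≠ T.root := by
    rintro rfl
    exact T.root_notMem_children v h
  exact (T.existsUnique_parent w (T.children_subset v h) hw).unique h h'

lemma exists_parent (hw : w ∈ verts n) (hr : w ≠ T.root) : ∃ v, w ∈ T.children v :=
  (T.existsUnique_parent w hw hr).exists

lemma root_eq (T : DecTree n) : T.root = 2 * n + 1 := by
  by_contra h
  obtain ⟨v, hv⟩ := exists_parent (T := T) (w := 2 * n + 1) (mem_Icc.2 ⟨by omega, le_rfl⟩)
    (Ne.symm h)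
  have h1 := T.decreasing v _ hv
  have h2 := (mem_Icc.1 (mem_Icc_of_mem_children hv)).2
  omega

lemma Desc.le (h : T.Desc v a) : a ≤ v := by
  induction h with
  | refl => exact le_rfl
  | tail _ h ih => exact (T.decreasing _ _ h).le.trans ih

lemma Desc.antisymm (h : T.Desc v a) (h' : T.Desc a v) : v = a := le_antisymm h'.le h.le

/-- Parents are unique, so the ancestors of a vertex form a chain. -/
lemma Desc.total (h : T.Desc v a) (h' : T.Desc w a) : T.Desc v w ∨ T.Desc w v := by
  have hU : Relator.RightUnique (Function.swap fun u w => w ∈ T.children u) :=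
    fun _ _ _ h1 h2 => parent_unique h1 h2
  rcases Relation.ReflTransGen.total_of_right_unique hU h.swap h'.swap with h | h
  · exact Or.inr h.swap
  · exact Or.inl h.swap

/-- Distinct children of a vertex have no common descendant. -/
lemma eq_of_desc_of_mem_children (hb : b ∈ T.children v) (hc : c ∈ T.children v)
    (h : T.Desc b a) (h' : T.Desc c a) : b = c := by
  have key : ∀ {b c}, b ∈ T.children v → c ∈ T.children v → T.Desc b c → b = c := by
    intro b c hb hc h
    rcases Relation.ReflTransGen.cases_tail h with e | ⟨u, hu, huc⟩
    · exact e.symm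
    · have h1 := Desc.le hu
      rw [parent_unique huc hc] at h1
      exact absurd h1 (T.decreasing _ _ hb).not_ge
  rcases h.total h' with h | h
  · exact key hb hc h
  · exact (key hc hb h).symm

lemma children_eq_pair (T : DecTree n) (hv : v ∈ Icc (n + 2) (2 * n + 1)) :
    ∃ b c, b ≠ c ∧ T.children v = {b, c} := card_eq_two.1 (T.card_children v hv)

/-! ### Leaf sets -/

lemma mem_leafSet : a ∈ T.leafSet v ↔ a ∈ Icc 1 (n + 1) ∧ T.Desc v a := by
  simp [leafSet, Desc]

lemma leafSet_subset_of_desc (h : T.Desc v w) : T.leafSet w ⊆ T.leafSet v := fun a ha => by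
  rw [mem_leafSet] at ha ⊢
  exact ⟨ha.1, h.trans ha.2⟩

lemma leafSet_of_le (hv : v ∈ Icc 1 (n + 1)) : T.leafSet v = {v} := by
  ext a
  rw [mem_leafSet, mem_singleton]
  constructor
  · rintro ⟨-, h⟩
    rcases Relation.ReflTransGen.cases_head h with e | ⟨u, hu, -⟩
    · exact e.symm
    · have h1 := (mem_Icc.1 (mem_Icc_of_mem_children hu)).1
      have h2 := (mem_Icc.1 hv).2
      omega
  · rintro rfl
    exact ⟨hv, .refl⟩

lemma leafSet_eq_biUnion (hv : n + 2 ≤ v) : T.leafSet v = (T.children v).biUnion T.leafSet := by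
  ext a
  simp only [mem_leafSet, mem_biUnion]
  constructor
  · rintro ⟨ha, h⟩
    rcases Relation.ReflTransGen.cases_head h with e | ⟨u, hu, h⟩
    · have := (mem_Icc.1 ha).2
      omega
    · exact ⟨u, hu, ha, h⟩
  · rintro ⟨u, hu, ha, h⟩
    exact ⟨ha, .head hu h⟩

lemma leafSet_eq_union (hv : n + 2 ≤ v) (h : T.children v = {b, c}) :
    T.leafSet v = T.leafSet b ∪ T.leafSet c := by
  rw [leafSet_eq_biUnion hv, h, biUnion_insert, singleton_biUnion]

lemma leafSet_nonempty (hv : v ∈ verts n) : (T.leafSet v).Nonempty := by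
  induction v using Nat.strong_induction_on with
  | _ v ih =>
    by_cases h : v ≤ n + 1
    · rw [leafSet_of_le (mem_Icc.2 ⟨(mem_Icc.1 hv).1, h⟩)]
      exact singleton_nonempty v
    · have hv' : v ∈ Icc (n + 2) (2 * n + 1) := mem_Icc.2 ⟨by omega, (mem_Icc.1 hv).2⟩
      obtain ⟨b, c, -, hbc⟩ := T.children_eq_pair hv'
      have hb : b ∈ T.children v := by simp [hbc]
      exact (ih b (T.decreasing v b hb) (T.children_subset v hb)).mono
        (leafSet_subset_of_desc (.single hb))

/-- Fullness is essential: were `v` a proper descendant of `w`, then `w` would have a second child,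
whose leaves are not below `v`. -/
lemma leafSet_subset_iff (hw : w ∈ verts n) :
    T.leafSet w ⊆ T.leafSet v ↔ T.Desc v w := by
  refine ⟨fun h => ?_, leafSet_subset_of_desc⟩
  obtain ⟨a, ha⟩ := leafSet_nonempty (T := T) hw
  rcases (mem_leafSet.1 (h ha)).2.total (mem_leafSet.1 ha).2 with h' | h'
  · exact h'
  · rcases Relation.ReflTransGen.cases_head h' with e | ⟨c, hc, hcv⟩
    · exact e ▸ .refl
    · obtain ⟨d, hd, hdc⟩ : ∃ d ∈ T.children w, d ≠ c :=
        exists_mem_ne (by rw [T.card_children w (mem_Icc_of_mem_children hc)]; simp) c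
      obtain ⟨b, hb⟩ := leafSet_nonempty (T := T) (T.children_subset w hd)
      have hb' := leafSet_subset_of_desc hcv (h (leafSet_subset_of_desc (.single hd) hb))
      exact absurd (eq_of_desc_of_mem_children hd hc (mem_leafSet.1 hb).2 (mem_leafSet.1 hb').2) hdc

lemma leafSet_injOn : Set.InjOn T.leafSet (verts n) := fun _ hv _ hw h =>
  ((leafSet_subset_iff (mem_coe.1 hw)).1 h.ge).antisymm
    ((leafSet_subset_iff (mem_coe.1 hv)).1 h.le)

lemma leafSet_inj (hv : v ∈ verts n) (hw : w ∈ verts n) :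
    T.leafSet v = T.leafSet w ↔ v = w :=
  ⟨fun h => leafSet_injOn (mem_coe.2 hv) (mem_coe.2 hw) h, fun h => h ▸ rfl⟩

/-- The children of `v` are its maximal proper descendants. -/
lemma mem_children_iff_desc : c ∈ T.children v ↔
    T.Desc v c ∧ v ≠ c ∧ ∀ d, T.Desc v d → T.Desc d c → d = v ∨ d = c := by
  constructor
  · intro h
    have hlt := T.decreasing v c h
    refine ⟨.single h, hlt.ne', fun d hvd hdc => ?_⟩
    rcases Relation.ReflTransGen.cases_tail hdc with e | ⟨u, hu, huc⟩
    · exact Or.inr e.symm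
    · rw [parent_unique huc h] at hu
      exact Or.inl (Desc.antisymm hu hvd)
  · rintro ⟨h, hne, hmax⟩
    rcases Relation.ReflTransGen.cases_head h with e | ⟨u, hu, huc⟩
    · exact absurd e hne
    · rcases hmax u (.single hu) huc with rfl | rfl
      · exact absurd (T.decreasing _ _ hu) (lt_irrefl _)
      · exact hu

lemma mem_verts_of_desc (h : T.Desc v a) (hv : v ∈ verts n) : a ∈ verts n := by
  rcases Relation.ReflTransGen.cases_tail h with rfl | ⟨u, -, hu⟩
  · exact hv
  · exact T.children_subset u hu

/-- A relabeling that is compatible with leaf sets is compatible with children. -/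
lemma mem_children_of_leafSet (σ : Equiv.Perm ℕ) (hσ : ∀ v, σ v ∈ verts n ↔ v ∈ verts n)
    (h : ∀ v ∈ verts n, S.leafSet (σ v) = T.leafSet v) (v c : ℕ) :
    σ c ∈ S.children (σ v) ↔ c ∈ T.children v := by
  -- Descent is containment of leaf sets, and children are the maximal proper descendants, so leaf
  -- sets carry the whole tree structure.
  have hD : ∀ {v c}, v ∈ verts n → (S.Desc (σ v) (σ c) ↔ T.Desc v c) := by
    intro v c hv
    constructor
    · intro hd
      have hc := (hσ c).1 (mem_verts_of_desc hd ((hσ v).2 hv))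
      rw [← leafSet_subset_iff hc, ← h v hv, ← h c hc]
      exact leafSet_subset_of_desc hd
    · intro hd
      have hc := mem_verts_of_desc hd hv
      rw [← leafSet_subset_iff ((hσ c).2 hc), h v hv, h c hc]
      exact leafSet_subset_of_desc hd
  by_cases hv : v ∈ verts n
  · rw [mem_children_iff_desc, mem_children_iff_desc, hD hv, Ne, σ.injective.eq_iff]
    refine and_congr_right fun _ => and_congr_right fun _ => ?_
    rw [← σ.forall_congr_right]
    refine forall_congr' fun d => ?_
    rw [hD hv, σ.injective.eq_iff, σ.injective.eq_iff]
    exact imp_congr_right fun hd => by rw [hD (mem_verts_of_desc hd hv)]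
  · exact iff_of_false (fun h => hv ((hσ v).1 (mem_verts_of_mem_children h)))
      fun h => hv (mem_verts_of_mem_children h)

/-! ### The partitions attached to a tree -/

open Classical in
/-- The roots of the restriction of the tree to the vertices with label at most `k`. -/
noncomputable def roots (T : DecTree n) (k : ℕ) : Finset ℕ :=
  {v ∈ verts n | v ≤ k ∧ ∀ u ≤ k, v ∉ T.children u}

lemma mem_roots : v ∈ T.roots k ↔ v ∈ verts n ∧ v ≤ k ∧ ∀ u ≤ k, v ∉ T.children u := by
  simp only [roots, mem_filter]

lemma roots_subset : T.roots k ⊆ verts n := fun _ h => (mem_roots.1 h).1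

/-- Passing to parents raises the label, so a climb within labels at most `k` stops, and it stops at
a root. -/
lemma exists_mem_roots (ha : a ∈ verts n) (hak : a ≤ k) : ∃ r ∈ T.roots k, T.Desc r a := by
  induction hm : k - a using Nat.strong_induction_on generalizing a with
  | _ m ih =>
    by_cases h : ∀ u ≤ k, a ∉ T.children u
    · exact ⟨a, mem_roots.2 ⟨ha, hak, h⟩, .refl⟩
    · push Not at h
      obtain ⟨u, huk, hu⟩ := h
      have := T.decreasing u a hu
      obtain ⟨r, hr, hru⟩ := ih (k - u) (by omega) (mem_verts_of_mem_children hu) huk rfl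
      exact ⟨r, hr, hru.tail hu⟩

lemma reachable_of_desc (hr : r ≤ k) (h : T.Desc r a) : (T.restrict k).Reachable r a := by
  induction h with
  | refl => exact .refl _
  | @tail u w hu hw ih =>
    refine ih.trans (SimpleGraph.Adj.reachable ?_)
    have hlt := T.decreasing u w hw
    have := Desc.le hu
    rw [restrict, SimpleGraph.fromRel_adj]
    exact ⟨hlt.ne', Or.inl ⟨hw, by omega, by omega⟩⟩

/-- An edge could leave the set of descendants of `r` only from `r` to its parent, but a root has no
parent with label at most `k`. -/
lemma reachable_iff (hr : r ∈ T.roots k) (ha : T.Desc r a) :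
    (T.restrict k).Reachable a b ↔ T.Desc r b := by
  have hrk := (mem_roots.1 hr).2.1
  constructor
  · intro h
    rw [SimpleGraph.reachable_iff_reflTransGen] at h
    have key : ∀ {u w}, w ∈ T.children u → u ≤ k → (T.Desc r u ↔ T.Desc r w) := by
      intro u w hw huk
      refine ⟨fun h => h.tail hw, fun h => ?_⟩
      rcases Relation.ReflTransGen.cases_tail h with rfl | ⟨u', hu', hw'⟩
      · exact absurd hw ((mem_roots.1 hr).2.2 u huk)
      · rwa [parent_unique hw hw']
    induction h with
    | refl => exact ha
    | tail _ hadj ih =>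
      rw [restrict, SimpleGraph.fromRel_adj] at hadj
      rcases hadj.2 with ⟨h1, h2, -⟩ | ⟨h1, h2, -⟩
      · exact (key h1 h2).1 ih
      · exact (key h1 h2).2 ih
  · intro h
    exact (reachable_of_desc hrk ha).symm.trans (reachable_of_desc hrk h)

lemma parts_partitionAt (T : DecTree n) (i : ℕ) :
    (T.partitionAt i).parts = (T.roots (n + 1 + i)).image T.leafSet := by
  classical
  have key : ∀ a ∈ Icc 1 (n + 1), ∀ r ∈ T.roots (n + 1 + i), T.Desc r a →
      {b ∈ Icc 1 (n + 1) | (T.restrict (n + 1 + i)).reachableSetoid a b} = T.leafSet r := by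
    intro a ha r hr hra
    ext b
    rw [mem_filter, mem_leafSet, ← reachable_iff hr hra]
    rfl
  ext B
  simp only [partitionAt, Finpartition.ofSetSetoid_parts, mem_image]
  constructor
  · rintro ⟨a, ha, rfl⟩
    have := mem_Icc.1 ha
    obtain ⟨r, hr, hra⟩ := exists_mem_roots (T := T) (a := a) (k := n + 1 + i)
      (mem_Icc.2 ⟨this.1, by omega⟩) (by omega)
    refine ⟨r, hr, ?_⟩
    rw [← key a ha r hr hra]
  · rintro ⟨r, hr, rfl⟩
    obtain ⟨a, ha⟩ := leafSet_nonempty (T := T) (roots_subset hr)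
    rw [mem_leafSet] at ha
    refine ⟨a, ha.1, ?_⟩
    rw [← key a ha.1 r hr ha.2]

lemma children_subset_roots : T.children (k + 1) ⊆ T.roots k := fun c hc => by
  have h1 := T.decreasing _ c hc
  refine mem_roots.2 ⟨T.children_subset _ hc, by omega, fun u hu hcu => ?_⟩
  have := parent_unique hc hcu
  omega

/-- The parent of `k + 1` has a larger label, so `k + 1` enters as a root, and only its children
cease to be roots. -/
lemma roots_succ (hk : k + 1 ≤ 2 * n + 1) :
    T.roots (k + 1) = insert (k + 1) (T.roots k \ T.children (k + 1)) := by
  ext v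
  simp only [mem_insert, mem_sdiff, mem_roots]
  constructor
  · rintro ⟨hv, hvk, h⟩
    by_cases e : v = k + 1
    · exact Or.inl e
    · exact Or.inr ⟨⟨hv, by omega, fun u hu => h u (by omega)⟩, h _ le_rfl⟩
  · rintro (rfl | ⟨⟨hv, hvk, h⟩, h'⟩)
    · refine ⟨mem_Icc.2 ⟨by omega, hk⟩, le_rfl, fun u hu hcu => ?_⟩
      have := T.decreasing _ _ hcu
      omega
    · refine ⟨hv, by omega, fun u hu => ?_⟩
      rcases Nat.lt_or_eq_of_le hu with hu | rfl
      · exact h u (by omega)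
      · exact h'

/-- The partition of index `i + 1` arises by merging the leaf sets of the children of the vertex
`n + 1 + i + 1`. -/
lemma parts_partitionAt_succ (hi : i < n) (h : T.children (n + 1 + i + 1) = {b, c}) (hbc : b ≠ c) :
    T.leafSet b ∈ (T.partitionAt i).parts ∧ T.leafSet c ∈ (T.partitionAt i).parts ∧
    T.leafSet b ≠ T.leafSet c ∧
    (T.partitionAt (i + 1)).parts = insert (T.leafSet b ∪ T.leafSet c)
      (((T.partitionAt i).parts.erase (T.leafSet b)).erase (T.leafSet c)) := by
  have hsub := children_subset_roots (T := T) (k := n + 1 + i)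
  have hb : b ∈ T.roots (n + 1 + i) := hsub (by simp [h])
  have hc : c ∈ T.roots (n + 1 + i) := hsub (by simp [h])
  simp only [parts_partitionAt]
  refine ⟨mem_image_of_mem _ hb, mem_image_of_mem _ hc, ?_, ?_⟩
  · exact fun e => hbc ((leafSet_inj (roots_subset hb) (roots_subset hc)).1 e)
  · change (T.roots (n + 1 + i + 1)).image T.leafSet = _
    rw [roots_succ (by omega), image_insert, leafSet_eq_union (by omega) h, h]
    congr 1
    ext B
    simp only [mem_image, mem_sdiff, mem_insert, mem_singleton, mem_erase]
    constructor
    · rintro ⟨r, ⟨hr, hr'⟩, rfl⟩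
      rw [not_or] at hr'
      exact ⟨fun e => hr'.2 ((leafSet_inj (roots_subset hr) (roots_subset hc)).1 e),
        fun e => hr'.1 ((leafSet_inj (roots_subset hr) (roots_subset hb)).1 e), r, hr, rfl⟩
    · rintro ⟨h1, h2, r, hr, rfl⟩
      refine ⟨r, ⟨hr, ?_⟩, rfl⟩
      rintro (rfl | rfl)
      · exact h2 rfl
      · exact h1 rfl

lemma partitionAt_covBy (T : DecTree n) (hi : i < n) :
    T.partitionAt i ⋖ T.partitionAt (i + 1) := by
  obtain ⟨b, c, hbc, h⟩ := T.children_eq_pair (v := n + 1 + i + 1) (mem_Icc.2 (by omega))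
  obtain ⟨hb, hc, hne, hp⟩ := parts_partitionAt_succ hi h hbc
  exact covBy_of_parts_eq hb hc hne hp

lemma partitionAt_sdiff (T : DecTree n) (hi : i < n) :
    (T.partitionAt i).parts \ (T.partitionAt (i + 1)).parts =
      (T.children (n + 1 + i + 1)).image T.leafSet := by
  obtain ⟨b, c, hbc, h⟩ := T.children_eq_pair (v := n + 1 + i + 1) (mem_Icc.2 (by omega))
  obtain ⟨hb, hc, hne, hp⟩ := parts_partitionAt_succ hi h hbc
  rw [(sdiff_of_parts_eq hb hc hne hp).1, h, image_insert, image_singleton]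

lemma partitionAt_succ_sdiff (T : DecTree n) (hi : i < n) :
    (T.partitionAt (i + 1)).parts \ (T.partitionAt i).parts = {T.leafSet (n + 1 + i + 1)} := by
  obtain ⟨b, c, hbc, h⟩ := T.children_eq_pair (v := n + 1 + i + 1) (mem_Icc.2 (by omega))
  obtain ⟨hb, hc, hne, hp⟩ := parts_partitionAt_succ hi h hbc
  rw [(sdiff_of_parts_eq hb hc hne hp).2, leafSet_eq_union (by omega) h]

lemma mem_children_iff_mem_sdiff (hi : i < n) : c ∈ T.children (n + 1 + i + 1) ↔
    c ∈ verts n ∧ T.leafSet c ∈ (T.partitionAt i).parts \ (T.partitionAt (i + 1)).parts := by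
  rw [T.partitionAt_sdiff hi, mem_image]
  constructor
  · exact fun h => ⟨T.children_subset _ h, c, h, rfl⟩
  · rintro ⟨hc, d, hd, hdc⟩
    rwa [← (leafSet_inj (T.children_subset _ hd) hc).1 hdc]

/-- The blocks lost in this step are the leaf sets of the children, so both sides are the supremum
of the same minima. -/
lemma maxMinLabel_partitionAt (T : DecTree n) (hi : i < n) :
    maxMinLabel n (T.partitionAt i) (T.partitionAt (i + 1)) = T.vertexLabel (n + 1 + i + 1) := by
  rw [maxMinLabel, T.partitionAt_sdiff hi, sup_image]
  rfl

lemma partitionAt_zero (T : DecTree n) : T.partitionAt 0 = ⊥ := by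
  refine le_bot_iff.1 fun B hB => ?_
  rw [parts_partitionAt] at hB
  obtain ⟨r, hr, rfl⟩ := mem_image.1 hB
  obtain ⟨h1, h2, -⟩ := mem_roots.1 hr
  have hr : r ∈ Icc 1 (n + 1) := mem_Icc.2 ⟨(mem_Icc.1 h1).1, h2⟩
  exact ⟨{r}, Finpartition.mem_bot_iff.2 ⟨r, hr, rfl⟩, (leafSet_of_le hr).le⟩

lemma leafSet_root (T : DecTree n) : T.leafSet (2 * n + 1) = Icc 1 (n + 1) := by
  ext a
  rw [mem_leafSet, and_iff_left_iff_imp]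
  intro ha
  have ha' : a ∈ verts n := mem_Icc.2 ⟨(mem_Icc.1 ha).1, by have := (mem_Icc.1 ha).2; omega⟩
  obtain ⟨r, hr, hra⟩ := exists_mem_roots (T := T) (k := 2 * n + 1) ha' (mem_Icc.1 ha').2
  obtain ⟨h1, h2, h3⟩ := mem_roots.1 hr
  by_cases hrr : r = T.root
  · rwa [← T.root_eq, ← hrr]
  · obtain ⟨u, hu⟩ := exists_parent h1 hrr
    exact absurd hu (h3 u (mem_Icc.1 (mem_verts_of_mem_children hu)).2)

lemma partitionAt_last (T : DecTree n) : T.partitionAt n = ⊤ := by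
  refine top_le_iff.1 fun B hB => ⟨T.leafSet (2 * n + 1), ?_, ?_⟩
  · rw [parts_partitionAt]
    refine mem_image_of_mem _
      (mem_roots.2 ⟨mem_Icc.2 ⟨by omega, le_rfl⟩, by omega, fun u _ h => ?_⟩)
    rw [← T.root_eq] at h
    exact T.root_notMem_children u h
  · rw [leafSet_root]
    exact Finpartition.subset _ hB

lemma isSaturatedChain_chainList (T : DecTree n) : IsSaturatedChain ⊥ ⊤ T.chainList := by
  refine ⟨?_, ?_, ?_⟩
  · rw [chainList, List.isChain_map, List.isChain_range_succ]
    exact fun i hi => T.partitionAt_covBy hi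
  · simp [chainList, List.head?_range, partitionAt_zero]
  · simp [chainList, List.getLast?_range, partitionAt_last]

/-- The maximal chain attached to a tree. -/
noncomputable def toMaxChain (T : DecTree n) : MaxChain (PartitionLattice n) :=
  ⟨T.chainList, T.isSaturatedChain_chainList⟩

end DecTree

namespace DecTree

variable {n : ℕ} {T S : DecTree n} {v w a b c r k i : ℕ}

/-! ### Trees are determined by their chains -/

lemma ext_children (h : ∀ v c, c ∈ T.children v ↔ c ∈ S.children v) : T = S :=
  DecTree.ext (T.root_eq.trans S.root_eq.symm) (funext fun v => Finset.ext (h v))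

lemma leafSet_congr (hi : i < n) (h : T.partitionAt i = S.partitionAt i)
    (h' : T.partitionAt (i + 1) = S.partitionAt (i + 1)) :
    T.leafSet (n + 1 + i + 1) = S.leafSet (n + 1 + i + 1) := by
  rw [← singleton_inj, ← T.partitionAt_succ_sdiff hi, ← S.partitionAt_succ_sdiff hi, h, h']

lemma leaf_or_exists_index (hv : v ∈ verts n) : v ∈ Icc 1 (n + 1) ∨ ∃ i < n, v = n + 1 + i + 1 := by
  have := mem_Icc.1 hv
  by_cases h : v ≤ n + 1
  · exact Or.inl (mem_Icc.2 ⟨this.1, h⟩)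
  · exact Or.inr ⟨v - (n + 2), by omega, by omega⟩

/-- The leaf set of an internal vertex is the block created in its step, so the chain fixes all leaf
sets, and these fix the children. -/
lemma eq_of_partitionAt_eq (h : ∀ i ≤ n, T.partitionAt i = S.partitionAt i) : T = S := by
  refine ext_children fun v c => ?_
  refine (mem_children_of_leafSet (T := S) (S := T) (Equiv.refl ℕ) (fun _ => Iff.rfl) ?_ v c)
  intro v hv
  rcases leaf_or_exists_index hv with hv | ⟨i, hi, rfl⟩
  · exact (leafSet_of_le hv).trans (leafSet_of_le hv).symm
  · exact leafSet_congr hi (h i hi.le) (h (i + 1) hi)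

lemma chainList_eq_iff : T.chainList = S.chainList ↔
    ∀ i ≤ n, T.partitionAt i = S.partitionAt i := by
  simp only [chainList, List.map_inj_left, List.mem_range, Nat.lt_succ_iff]

lemma toMaxChain_injective : Function.Injective (toMaxChain (n := n)) := fun _ _ h =>
  eq_of_partitionAt_eq (chainList_eq_iff.1 (Subtype.ext_iff.1 h))

end DecTree

/-! ### The tree of a maximal chain -/

open DecTree

lemma exists_eq_map_range {n : ℕ} (m : MaxChain (PartitionLattice n)) :
    ∃ f : ℕ → PartitionLattice n, m.1 = (List.range (n + 1)).map f ∧ f 0 = ⊥ ∧ f n = ⊤ ∧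
      ∀ i < n, f i ⋖ f (i + 1) := by
  -- Each step loses one block, from `n + 1` blocks in `⊥` down to one in `⊤`.
  have hlen : m.1.length = n + 1 := by
    have h := length_of_isSaturatedChain m.2
    have htop : (⊤ : PartitionLattice n).parts.card = 1 := by
      refine le_antisymm (card_le_one.2 fun A hA B hB => ?_) (card_pos.2 ?_)
      · exact Finpartition.parts_top_subsingleton _ (mem_coe.2 hA) (mem_coe.2 hB)
      · exact Finpartition.parts_nonempty _ (by simp)
    rw [card_minSet, card_minSet, htop, Finpartition.card_bot, Nat.card_Icc] at h
    omega
  have hm : m.1 = (List.range (n + 1)).map fun i => m.1.getD i ⊥ := by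
    refine List.ext_getElem (by simp [hlen]) fun i h1 h2 => ?_
    rw [List.getElem_map, List.getElem_range, List.getD_eq_getElem _ _ h1]
  obtain ⟨h1, h2, h3⟩ := m.2
  generalize (fun i => m.1.getD i ⊥) = f at hm
  rw [hm] at h1 h2 h3
  rw [List.isChain_map, List.isChain_range_succ] at h1
  exact ⟨f, hm, by simpa [List.head?_range] using h2, by simpa [List.getLast?_range] using h3, h1⟩

section Build

variable {n : ℕ} (f : ℕ → PartitionLattice n)

/-- The block attached to a vertex: a singleton for a leaf, and the block that is new in `f i`
for the vertex `n + 1 + i`. -/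
def block (v : ℕ) : Finset ℕ :=
  if v ≤ n + 1 then {v} else ((f (v - (n + 1))).parts \ (f (v - (n + 2))).parts).sup id

/-- The children of `n + 1 + i` are the vertices whose blocks are in `f (i - 1)` but not
in `f i`. -/
def blockChildren (v : ℕ) : Finset ℕ :=
  if v ∈ Icc (n + 2) (2 * n + 1) then
    {w ∈ verts n | block f w ∈ (f (v - (n + 2))).parts \ (f (v - (n + 1))).parts} else ∅

variable {f} {v w i j k : ℕ} {B : Finset ℕ}

lemma block_leaf (hv : v ≤ n + 1) : block f v = {v} := if_pos hv

lemma mem_blockChildren (hi : i < n) : w ∈ blockChildren f (n + 1 + i + 1) ↔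
    w ∈ verts n ∧ block f w ∈ (f i).parts \ (f (i + 1)).parts := by
  rw [blockChildren, if_pos (mem_Icc.2 (by omega)), mem_filter,
    show n + 1 + i + 1 - (n + 2) = i by omega, show n + 1 + i + 1 - (n + 1) = i + 1 by omega]

variable (h0 : f 0 = ⊥) (hn : f n = ⊤) (hcov : ∀ i < n, f i ⋖ f (i + 1))

include hcov

/-- A cover creates exactly one block, so the supremum in the definition of `block` merely extracts
it. -/
lemma sdiff_eq_block (hi : i < n) :
    (f (i + 1)).parts \ (f i).parts = {block f (n + 1 + i + 1)} := by
  rw [block, if_neg (by omega), show n + 1 + i + 1 - (n + 2) = i by omega,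
    show n + 1 + i + 1 - (n + 1) = i + 1 by omega]
  obtain ⟨A, -, B, -, -, -, -, h⟩ := sdiff_of_covBy (hcov i hi)
  rw [h, sup_singleton, id]

lemma le_of_covBy_succ (hij : i ≤ j) (hj : j ≤ n) : f i ≤ f j := by
  induction j, hij using Nat.le_induction with
  | base => exact le_rfl
  | succ j _ ih => exact (ih (by omega)).trans (hcov j hj).le

lemma mem_parts_between (hij : i ≤ j) (hjk : j ≤ k) (hk : k ≤ n) (hi : B ∈ (f i).parts)
    (hB : B ∈ (f k).parts) : B ∈ (f j).parts :=
  mem_parts_of_le_of_le (le_of_covBy_succ hcov hij (hjk.trans hk)) (le_of_covBy_succ hcov hjk hk)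
    hi hB

lemma block_notMem (hi : i < n) : block f (n + 1 + i + 1) ∉ (f i).parts := by
  refine (mem_sdiff.1 (?_ : _ ∈ (f (i + 1)).parts \ _)).2
  rw [sdiff_eq_block hcov hi]
  exact mem_singleton_self _

include h0

lemma block_mem (hv : v ∈ verts n) : block f v ∈ (f (v - (n + 1))).parts := by
  rcases leaf_or_exists_index hv with hv | ⟨i, hi, rfl⟩
  · have := mem_Icc.1 hv
    -- For a leaf the truncated subtraction gives index `0`, where all blocks are singletons.
    rw [block_leaf this.2, show v - (n + 1) = 0 by omega, h0]
    exact Finpartition.mem_bot_iff.2 ⟨v, hv, rfl⟩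
  · rw [show n + 1 + i + 1 - (n + 1) = i + 1 by omega]
    refine (mem_sdiff.1 (?_ : _ ∈ _ \ (f i).parts)).1
    rw [sdiff_eq_block hcov hi]
    exact mem_singleton_self _

/-- A block of `f i` belongs to a vertex with label at most `n + 1 + i`. -/
lemma le_of_block_mem (hv : v ∈ verts n) (h : block f v ∈ (f i).parts) :
    v ≤ n + 1 + i := by
  by_contra hlt
  have := mem_Icc.1 hv
  obtain ⟨j, rfl⟩ : ∃ j, v = n + 1 + j + 1 := ⟨v - (n + 2), by omega⟩
  have hb := block_mem h0 hcov hv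
  rw [show n + 1 + j + 1 - (n + 1) = j + 1 by omega] at hb
  -- A block present at index `i` and at its creation would also be present just before its
  -- creation.
  exact block_notMem hcov (by omega)
    (mem_parts_between hcov (by omega) (Nat.le_succ j) (by omega) h hb)

/-- The later vertex would own a block already present at the index of the earlier one, and
`le_of_block_mem` then bounds its label. Leaves, all of index `0`, are told apart by their
singletons. -/
lemma block_inj (hv : v ∈ verts n) (hw : w ∈ verts n) (h : block f v = block f w) : v = w := by
  wlog hvw : v ≤ w generalizing v w
  · exact (this hw hv h.symm (by omega)).symm
  have h2 := mem_Icc.1 hv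
  have h3 := mem_Icc.1 hw
  by_cases hle : w ≤ n + 1
  · rw [block_leaf hle, block_leaf (by omega)] at h
    exact singleton_inj.1 h
  · have h1 := le_of_block_mem h0 hcov hw (h ▸ block_mem h0 hcov hv)
    by_cases hlv : v ≤ n + 1
    · omega
    · omega

lemma exists_block_eq (hi : i ≤ n) (hB : B ∈ (f i).parts) : ∃ v ∈ verts n, block f v = B := by
  induction i with
  | zero =>
    rw [h0, Finpartition.mem_bot_iff] at hB
    obtain ⟨a, ha, rfl⟩ := hB
    have := mem_Icc.1 ha
    exact ⟨a, mem_Icc.2 (by omega), block_leaf this.2⟩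
  | succ i ih =>
    by_cases h : B ∈ (f i).parts
    · exact ih (by omega) h
    · have : B ∈ (f (i + 1)).parts \ (f i).parts := mem_sdiff.2 ⟨hB, h⟩
      rw [sdiff_eq_block hcov hi, mem_singleton] at this
      exact ⟨_, mem_Icc.2 (by omega), this.symm⟩

lemma image_blockChildren (hi : i < n) :
    (blockChildren f (n + 1 + i + 1)).image (block f) = (f i).parts \ (f (i + 1)).parts := by
  ext B
  simp only [mem_image, mem_blockChildren hi]
  constructor
  · rintro ⟨v, ⟨-, h⟩, rfl⟩
    exact h
  · intro h
    obtain ⟨v, hv, rfl⟩ := exists_block_eq h0 hcov hi.le (mem_sdiff.1 h).1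
    exact ⟨v, ⟨hv, h⟩, rfl⟩

lemma blockChildren_spec (h : w ∈ blockChildren f v) :
    ∃ i < n, v = n + 1 + i + 1 ∧ w ∈ verts n ∧ w ≤ n + 1 + i ∧
      block f w ∈ (f i).parts \ (f (i + 1)).parts := by
  have hv : v ∈ Icc (n + 2) (2 * n + 1) := by
    by_contra hv
    rw [blockChildren, if_neg hv] at h
    simp at h
  have := mem_Icc.1 hv
  obtain ⟨i, rfl⟩ : ∃ i, v = n + 1 + i + 1 := ⟨v - (n + 2), by omega⟩
  have hi : i < n := by omega
  rw [mem_blockChildren hi] at h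
  exact ⟨i, hi, rfl, h.1, le_of_block_mem h0 hcov h.1 (mem_sdiff.1 h.2).1, h.2⟩

lemma card_blockChildren (hi : i < n) : (blockChildren f (n + 1 + i + 1)).card = 2 := by
  have hinj : Set.InjOn (block f) (blockChildren f (n + 1 + i + 1)) := by
    intro a ha b hb h
    rw [mem_coe, mem_blockChildren hi] at ha hb
    exact block_inj h0 hcov ha.1 hb.1 h
  rw [← card_image_of_injOn hinj, image_blockChildren h0 hcov hi]
  obtain ⟨A, -, B, -, hlt, -, h, -⟩ := sdiff_of_covBy (hcov i hi)
  rw [h, card_pair (by rintro rfl; exact hlt.false)]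

include hn

/-- The indices at which a block is present form an interval. It does not reach `n`, where only the
block of the root is left, so the block is lost in exactly one step, and that step names the parent.
-/
lemma existsUnique_blockParent (hw : w ∈ verts n) (hne : w ≠ 2 * n + 1) :
    ∃! v, w ∈ blockChildren f v := by
  have hlast : block f w ∉ (f n).parts := by
    intro h
    have hr : 2 * n + 1 ∈ verts n := mem_Icc.2 (by omega)
    have h' := block_mem h0 hcov hr
    rw [show 2 * n + 1 - (n + 1) = n by omega] at h'
    rw [hn] at h h'
    exact hne (block_inj h0 hcov hw hr
      (Finpartition.parts_top_subsingleton _ (mem_coe.2 h) (mem_coe.2 h')))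
  have hwn := mem_Icc.1 hw
  obtain ⟨i, hi, hi1, hi2⟩ : ∃ i < n, block f w ∈ (f i).parts ∧ block f w ∉ (f (i + 1)).parts := by
    by_contra! H
    have : ∀ j, w - (n + 1) ≤ j → j ≤ n → block f w ∈ (f j).parts := by
      intro j hj
      induction j, hj using Nat.le_induction with
      | base => exact fun _ => block_mem h0 hcov hw
      | succ j _ ih => exact fun hj => H j hj (ih (by omega))
    exact hlast (this n (by omega) le_rfl)
  refine ⟨n + 1 + i + 1, (mem_blockChildren hi).2 ⟨hw, mem_sdiff.2 ⟨hi1, hi2⟩⟩, ?_⟩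
  intro v hv
  obtain ⟨j, hj, rfl, -, -, hB⟩ := blockChildren_spec h0 hcov hv
  obtain ⟨hj1, hj2⟩ := mem_sdiff.1 hB
  rcases lt_trichotomy i j with h | rfl | h
  · exact absurd (mem_parts_between hcov (Nat.le_succ i) h hj.le hi1 hj1) hi2
  · rfl
  · exact absurd (mem_parts_between hcov (Nat.le_succ j) h hi.le hj1 hi1) hj2

/-- The tree attached to a maximal chain. -/
def treeOfChain : DecTree n where
  root := 2 * n + 1
  children := blockChildren f
  root_mem := mem_Icc.2 (by omega)
  children_subset v w hw := by
    obtain ⟨-, -, -, h, -⟩ := blockChildren_spec h0 hcov hw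
    exact h
  card_children v hv := by
    have := mem_Icc.1 hv
    obtain ⟨i, rfl⟩ : ∃ i, v = n + 1 + i + 1 := ⟨v - (n + 2), by omega⟩
    exact card_blockChildren h0 hcov (by omega)
  children_eq_empty v hv := if_neg hv
  root_notMem_children v hv := by
    obtain ⟨i, hi, -, -, h, -⟩ := blockChildren_spec h0 hcov hv
    omega
  existsUnique_parent w hw hne := existsUnique_blockParent h0 hn hcov hw hne
  decreasing v w hw := by
    obtain ⟨i, hi, rfl, -, h, -⟩ := blockChildren_spec h0 hcov hw
    omega

lemma leafSet_treeOfChain (hv : v ∈ verts n) :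
    (treeOfChain h0 hn hcov).leafSet v = block f v := by
  induction v using Nat.strong_induction_on with
  | _ v ih =>
    rcases leaf_or_exists_index hv with hv | ⟨i, hi, rfl⟩
    · rw [leafSet_of_le hv, block_leaf (mem_Icc.1 hv).2]
    · have himg := image_blockChildren h0 hcov hi
      obtain ⟨A, -, B, -, -, -, h1, h2⟩ := sdiff_of_covBy (hcov i hi)
      rw [sdiff_eq_block hcov hi] at h2
      rw [leafSet_eq_biUnion (by omega), singleton_inj.1 h2]
      have : A ∪ B = ((blockChildren f (n + 1 + i + 1)).image (block f)).biUnion id := by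
        rw [himg, h1, biUnion_insert, singleton_biUnion]
        rfl
      rw [this, image_biUnion]
      refine biUnion_congr rfl fun w hw => ?_
      obtain ⟨-, -, -, hw', h, -⟩ := blockChildren_spec h0 hcov hw
      exact ih w ((treeOfChain h0 hn hcov).decreasing _ _ hw) hw'

/-- A partition together with the blocks lost and created determines the next one, and these data
agree for the tree and for `f`. -/
lemma partitionAt_treeOfChain (hi : i ≤ n) : (treeOfChain h0 hn hcov).partitionAt i = f i := by
  induction i with
  | zero => rw [partitionAt_zero, h0]
  | succ i ih =>
    specialize ih (by omega)
    have key : ∀ x y : Finset (Finset ℕ), y = x \ (x \ y) ∪ y \ x := fun x y => by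
      ext B
      simp only [mem_union, mem_sdiff]
      tauto
    refine Finpartition.ext ?_
    rw [key (f i).parts (f (i + 1)).parts,
      key ((treeOfChain h0 hn hcov).partitionAt i).parts
        ((treeOfChain h0 hn hcov).partitionAt (i + 1)).parts,
      partitionAt_sdiff _ hi, partitionAt_succ_sdiff _ hi, sdiff_eq_block hcov hi,
      leafSet_treeOfChain h0 hn hcov (mem_Icc.2 (by omega)), ih,
      ← image_blockChildren h0 hcov hi]
    congr 2
    refine image_congr fun w hw => leafSet_treeOfChain h0 hn hcov ?_
    exact (treeOfChain h0 hn hcov).children_subset _ hw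

end Build

namespace DecTree

lemma toMaxChain_surjective {n : ℕ} : Function.Surjective (toMaxChain (n := n)) := by
  intro m
  obtain ⟨f, hm, h0, hn, hcov⟩ := exists_eq_map_range m
  refine ⟨treeOfChain h0 hn hcov, Subtype.ext ?_⟩
  rw [hm]
  refine List.map_congr_left fun i hi => partitionAt_treeOfChain h0 hn hcov ?_
  exact Nat.lt_succ_iff.1 (List.mem_range.1 hi)

end DecTree

/-- `y` is the least partition above `x` that joins the two halves of `C`, so `y ≤ z`, and both
cover `x`. -/
lemma eq_of_covBy_of_new_block {s : Finset ℕ} {x y z : Finpartition s} {C : Finset ℕ}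
    (hy : x ⋖ y) (hz : x ⋖ z) (hCy : C ∈ y.parts \ x.parts) (hCz : C ∈ z.parts) : y = z := by
  obtain ⟨A, hA, B, hB, -, hp, -, h⟩ := sdiff_of_covBy hy
  rw [h, mem_singleton] at hCy
  subst hCy
  have hyz : y ≤ z := by
    have : y = merge x hA hB := Finpartition.ext hp
    exact this ▸ merge_le hA hB hz.le hCz subset_union_left subset_union_right
  exact (hz.eq_or_eq hy.le hyz).resolve_left hy.lt.ne'

namespace DecTree

variable {n : ℕ} {T S : DecTree n} {v w a b c r k i j u : ℕ}

/-! ### Polygon moves between chains of trees -/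

lemma chainList_split (T : DecTree n) (hj : j + 1 < n) : T.chainList =
    (List.range j).map T.partitionAt ++
      [T.partitionAt j, T.partitionAt (j + 1), T.partitionAt (j + 2)] ++
      (List.range (n - (j + 2))).map fun d => T.partitionAt (j + 3 + d) := by
  have : n + 1 = j + 1 + 1 + 1 + (n - (j + 2)) := by omega
  rw [chainList, this, List.range_add]
  simp only [List.range_succ, List.map_append, List.map_map, List.append_assoc, List.map_cons,
    List.cons_append, List.nil_append]
  rfl

lemma chainList_getElem? (T : DecTree n) (hi : i ≤ n) :
    T.chainList[i]? = some (T.partitionAt i) := by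
  simp [chainList, Nat.lt_succ_iff.2 hi]

/-- The chains of two trees are related by a polygon move with middle index `j + 1`. -/
structure ChainMove (T S : DecTree n) (j : ℕ) : Prop where
  lt : j + 1 < n
  eq_of_ne : ∀ k ≤ n, k ≠ j + 1 → T.partitionAt k = S.partitionAt k
  ne : T.partitionAt (j + 1) ≠ S.partitionAt (j + 1)

lemma ChainMove.symm (h : ChainMove T S j) : ChainMove S T j :=
  ⟨h.lt, fun k hk hkj => (h.eq_of_ne k hk hkj).symm, h.ne.symm⟩

/-- The index is `j = p.length`: the common prefix `p` fills the indices below `j`, then `x` has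
index `j` and the replaced element `j + 1`. -/
lemma polygonMove_toMaxChain_iff :
    PolygonMove (maxMinLabel n) T.toMaxChain S.toMaxChain ↔ ∃ j, ChainMove T S j ∧
      T.vertexLabel (n + 1 + j + 1) < T.vertexLabel (n + 1 + j + 1 + 1) := by
  rw [polygonMove_iff]
  constructor
  · rintro ⟨p, s, x, y, y', z, hT, hS, hne, hlt⟩
    change T.chainList = _ at hT
    change S.chainList = _ at hS
    have hlen : T.chainList.length = n + 1 := by simp [chainList]
    have hj : p.length + 1 < n := by
      rw [hT] at hlen
      simp at hlen
      omega
    have hT' : ∀ k ≤ n, (p ++ [x, y, z] ++ s)[k]? = some (T.partitionAt k) := fun k hk =>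
      hT ▸ T.chainList_getElem? hk
    have hS' : ∀ k ≤ n, (p ++ [x, y', z] ++ s)[k]? = some (S.partitionAt k) := fun k hk =>
      hS ▸ S.chainList_getElem? hk
    have hset : p ++ [x, y', z] ++ s = (p ++ [x, y, z] ++ s).set (p.length + 1) y' := by
      simp
    have h0 : x = T.partitionAt p.length := by
      simpa [List.getElem?_append] using hT' p.length (by omega)
    have h1 : y = T.partitionAt (p.length + 1) := by
      simpa [List.getElem?_append] using hT' (p.length + 1) (by omega)
    have h2 : z = T.partitionAt (p.length + 2) := by
      simpa [List.getElem?_append] using hT' (p.length + 2) (by omega)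
    have h3 : y' = S.partitionAt (p.length + 1) := by
      simpa [List.getElem?_append] using hS' (p.length + 1) (by omega)
    refine ⟨p.length, ⟨hj, fun k hk hkj => ?_, h1 ▸ h3 ▸ hne⟩, ?_⟩
    · have := hS' k hk
      rw [hset, List.getElem?_set_ne (Ne.symm hkj), hT' k hk] at this
      exact Option.some.inj this
    · rw [h0, h1, h2, T.maxMinLabel_partitionAt (by omega), T.maxMinLabel_partitionAt hj] at hlt
      exact hlt
  · rintro ⟨j, ⟨hj, heq, hne⟩, hlt⟩
    refine ⟨_, _, _, _, S.partitionAt (j + 1), _, T.chainList_split hj, ?_, hne, ?_⟩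
    · change S.chainList = _
      rw [S.chainList_split hj, heq j (by omega) (by omega), heq (j + 2) (by omega) (by omega)]
      congr 1
      · congr 1
        refine List.map_congr_left fun k hk => (heq k ?_ ?_).symm <;>
        · have := List.mem_range.1 hk
          omega
      · refine List.map_congr_left fun k hk => (heq _ ?_ ?_).symm <;>
        · have := List.mem_range.1 hk
          omega
    · rw [T.maxMinLabel_partitionAt (by omega), T.maxMinLabel_partitionAt hj]
      exact hlt

/-! ### Moves of trees are polygon moves of chains -/

lemma IsLabelSwap.symm (h : IsLabelSwap u w T S) : IsLabelSwap u w S T := by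
  refine ⟨by rw [h.1, Equiv.swap_apply_self], fun v => ?_⟩
  have := h.2 (Equiv.swap u w v)
  rw [Equiv.swap_apply_self] at this
  rw [this, image_image]
  simp [Function.comp_def]

lemma IsLabelSwap.mem_children (h : IsLabelSwap u w T S) (hc : c ∈ T.children v) :
    Equiv.swap u w c ∈ S.children (Equiv.swap u w v) := by
  rw [h.2]
  exact mem_image_of_mem _ hc

lemma IsLabelSwap.leafSet_subset (h : IsLabelSwap u w T S) (hu : n + 1 < u) (hw : n + 1 < w) :
    T.leafSet v ⊆ S.leafSet (Equiv.swap u w v) := by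
  intro a ha
  rw [mem_leafSet] at ha ⊢
  refine ⟨ha.1, ?_⟩
  have hle := (mem_Icc.1 ha.1).2
  have : S.Desc (Equiv.swap u w v) (Equiv.swap u w a) :=
    Relation.ReflTransGen.lift (p := fun u w => w ∈ S.children u) (Equiv.swap u w)
      (fun _ _ h' => h.mem_children h') _ _ ha.2
  rwa [Equiv.swap_apply_of_ne_of_ne (x := a) (by omega) (by omega)] at this

lemma IsLabelSwap.leafSet_eq (h : IsLabelSwap u w T S) (hu : n + 1 < u) (hw : n + 1 < w) :
    S.leafSet (Equiv.swap u w v) = T.leafSet v := by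
  refine subset_antisymm ?_ (h.leafSet_subset hu hw)
  simpa using h.symm.leafSet_subset (v := Equiv.swap u w v) hu hw

/-- Only the threshold `u` separates the labels `u` and `u + 1`. -/
lemma swap_succ_le_iff (hk : k ≠ u) : Equiv.swap u (u + 1) v ≤ k ↔ v ≤ k := by
  rw [Equiv.swap_apply_def]
  split_ifs <;> omega

lemma swap_mem_verts (hu : u ∈ verts n) (hw : w ∈ verts n) :
    Equiv.swap u w v ∈ verts n ↔ v ∈ verts n := by
  rw [Equiv.swap_apply_def]
  split_ifs with h1 h2
  · exact iff_of_true hw (h1 ▸ hu)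
  · exact iff_of_true hu (h2 ▸ hw)
  · rfl

lemma IsLabelSwap.parts_subset (h : IsLabelSwap u (u + 1) T S) (hu : n + 1 < u)
    (hun : u + 1 ≤ 2 * n + 1) (hk : n + 1 + k ≠ u) :
    (T.partitionAt k).parts ⊆ (S.partitionAt k).parts := by
  simp only [parts_partitionAt]
  intro B hB
  obtain ⟨r, hr, rfl⟩ := mem_image.1 hB
  rw [mem_roots] at hr
  refine mem_image.2 ⟨Equiv.swap u (u + 1) r, mem_roots.2 ⟨?_, ?_, fun v hv hrv => ?_⟩,
    h.leafSet_eq hu (by omega)⟩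
  · exact (swap_mem_verts (mem_Icc.2 (by omega)) (mem_Icc.2 (by omega))).2 hr.1
  · exact (swap_succ_le_iff hk).2 hr.2.1
  · have := h.symm.mem_children hrv
    rw [Equiv.swap_apply_self] at this
    exact hr.2.2 _ ((swap_succ_le_iff hk).2 hv) this

lemma IsLabelSwap.ne (h : IsLabelSwap u (u + 1) T S) (hu : u ∈ Icc (n + 2) (2 * n + 1)) :
    T ≠ S := by
  rintro rfl
  obtain ⟨b, c, -, hbc⟩ := T.children_eq_pair hu
  have hb : b ∈ T.children u := by simp [hbc]
  have hlt := T.decreasing u b hb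
  have := h.mem_children hb
  rw [Equiv.swap_apply_left, Equiv.swap_apply_of_ne_of_ne (by omega) (by omega)] at this
  have := parent_unique hb this
  omega

lemma IsLabelSwap.chainMove (hj : j + 1 < n)
    (h : IsLabelSwap (n + 1 + j + 1) (n + 1 + j + 1 + 1) T S) : ChainMove T S j := by
  have heq : ∀ k ≤ n, k ≠ j + 1 → T.partitionAt k = S.partitionAt k := fun k _ hkj =>
    Finpartition.ext (subset_antisymm (h.parts_subset (by omega) (by omega) (by omega))
      (h.symm.parts_subset (by omega) (by omega) (by omega)))
  refine ⟨hj, heq, fun e => h.ne (mem_Icc.2 (by omega)) (eq_of_partitionAt_eq fun k hk => ?_)⟩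
  by_cases hkj : k = j + 1
  · exact hkj ▸ e
  · exact heq k hk hkj

/-- In this form the leaf set depends on the two child sets only through their union, which a
subtree swap preserves. -/
lemma mem_leafSet_of_mem_children (hw : n + 2 ≤ w) (hu : n + 2 ≤ u) (h : u ∈ T.children w) :
    a ∈ T.leafSet w ↔
      ∃ c, (c ∈ T.children u ∨ c ∈ T.children w) ∧ c ≠ u ∧ a ∈ T.leafSet c := by
  rw [leafSet_eq_biUnion hw, mem_biUnion]
  constructor
  · rintro ⟨c, hc, ha⟩
    by_cases hcu : c = u
    · subst hcu
      rw [leafSet_eq_biUnion hu, mem_biUnion] at ha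
      obtain ⟨d, hd, ha⟩ := ha
      exact ⟨d, Or.inl hd, (T.decreasing _ _ hd).ne, ha⟩
    · exact ⟨c, Or.inr hc, hcu, ha⟩
  · rintro ⟨c, hc | hc, -, ha⟩
    · exact ⟨u, h, leafSet_subset_of_desc (.single hc) ha⟩
    · exact ⟨c, hc, ha⟩

lemma IsSubtreeSwap.mem_children_or (h : IsSubtreeSwap u w T S) :
    (c ∈ S.children u ∨ c ∈ S.children w) ↔ (c ∈ T.children u ∨ c ∈ T.children w) := by
  obtain ⟨hu, b, hb, hbu, a, ha, -, h1, h2, -⟩ := h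
  rw [h1, h2]
  simp only [mem_insert, mem_erase]
  by_cases hca : c = a
  · subst hca
    simp [ha]
  · by_cases hcb : c = b
    · subst hcb
      simp [hb]
    · simp [hca, hcb]

/-- At `w` the same three subtrees are merely regrouped, and no vertex other than `w` has `u` as a
child. -/
lemma IsSubtreeSwap.leafSet_eq (h : IsSubtreeSwap u w T S) (hu : n + 2 ≤ u) (hv : v ∈ verts n)
    (hvu : v ≠ u) : S.leafSet v = T.leafSet v := by
  have hor := fun c => h.mem_children_or (c := c)
  obtain ⟨huw, b, hb, hbu, a, -, -, h1, -, h3⟩ := h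
  have huw' : u ∈ S.children w := by
    rw [h1]
    simp [huw, Ne.symm hbu]
  have hlt := T.decreasing w u huw
  induction v using Nat.strong_induction_on with
  | _ v ih =>
    rcases leaf_or_exists_index hv with hv | ⟨i, hi, rfl⟩
    · rw [leafSet_of_le hv, leafSet_of_le hv]
    · by_cases hvw : n + 1 + i + 1 = w
      · rw [hvw]
        ext a
        rw [mem_leafSet_of_mem_children (by omega) hu huw,
          mem_leafSet_of_mem_children (by omega) hu huw']
        simp only [hor]
        refine exists_congr fun c => and_congr_right fun hc => and_congr_right fun hcu => ?_
        have hc' : c < w ∧ c ∈ verts n := by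
          rcases hc with hc | hc
          · exact ⟨(T.decreasing _ _ hc).trans hlt, T.children_subset _ hc⟩
          · exact ⟨T.decreasing _ _ hc, T.children_subset _ hc⟩
        rw [ih c (by omega) hc'.2 hcu]
      · rw [leafSet_eq_biUnion (by omega), leafSet_eq_biUnion (by omega), h3 _ hvu hvw]
        refine biUnion_congr rfl fun c hc => ?_
        exact ih c (T.decreasing _ _ hc) (T.children_subset _ hc)
          fun e => hvw (parent_unique (e ▸ hc) huw)

/-- For `k ≠ u` the vertices `u` and `u + 1` are both within the threshold or both beyond it, so
only the union of their child sets matters. -/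
lemma IsSubtreeSwap.roots_eq (h : IsSubtreeSwap u (u + 1) T S) (hk : k ≠ u) :
    S.roots k = T.roots k := by
  have hor := fun c => h.mem_children_or (c := c)
  obtain ⟨-, -, -, -, -, -, -, -, -, h3⟩ := h
  ext r
  rw [mem_roots, mem_roots]
  refine and_congr_right fun _ => and_congr_right fun _ => ?_
  have key : ∀ T' S' : DecTree n, (∀ c, (c ∈ S'.children u ∨ c ∈ S'.children (u + 1)) →
      (c ∈ T'.children u ∨ c ∈ T'.children (u + 1))) →
      (∀ v, v ≠ u → v ≠ u + 1 → S'.children v = T'.children v) →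
      (∀ v ≤ k, r ∉ T'.children v) → ∀ v ≤ k, r ∉ S'.children v := by
    intro T' S' h1 h2 h4 v hv hr
    have : ∀ v, v = u ∨ v = u + 1 → v ≤ k → r ∉ S'.children v := fun v hv hvk hr => by
      have : r ∈ S'.children u ∨ r ∈ S'.children (u + 1) := by
        rcases hv with rfl | rfl
        · exact Or.inl hr
        · exact Or.inr hr
      rcases h1 r this with h | h
      · exact h4 _ (by omega) h
      · exact h4 _ (by omega) h
    by_cases hvu : v = u
    · exact this v (Or.inl hvu) hv hr
    by_cases hvw : v = u + 1
    · exact this v (Or.inr hvw) hv hr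
    exact h4 v hv (h2 v hvu hvw ▸ hr)
  exact ⟨key S T (fun c => (hor c).2) fun v h h' => (h3 v h h').symm,
    key T S (fun c => (hor c).1) h3⟩

lemma IsSubtreeSwap.ne (h : IsSubtreeSwap u w T S) : T ≠ S := by
  rintro rfl
  obtain ⟨hu, b, -, -, a, ha, -, h1, -, -⟩ := h
  have haw : a ∈ T.children w := by
    rw [h1]
    exact mem_insert_self _ _
  have := T.decreasing _ _ hu
  have := parent_unique ha haw
  omega

lemma IsSubtreeSwap.chainMove (hj : j + 1 < n)
    (h : IsSubtreeSwap (n + 1 + j + 1) (n + 1 + j + 1 + 1) T S) : ChainMove T S j := by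
  have heq : ∀ k ≤ n, k ≠ j + 1 → T.partitionAt k = S.partitionAt k := by
    intro k hk hkj
    refine Finpartition.ext ?_
    rw [parts_partitionAt, parts_partitionAt, h.roots_eq (by omega)]
    refine image_congr fun r hr => (h.leafSet_eq (by omega) (roots_subset hr) ?_).symm
    -- This vertex is a root only at index `j + 1`: earlier it is absent, later its parent is
    -- present.
    rintro rfl
    have h1 := (mem_roots.1 hr).2.1
    exact (mem_roots.1 hr).2.2 _ (by omega) h.1
  refine ⟨hj, heq, fun e => h.ne (eq_of_partitionAt_eq fun k hk => ?_)⟩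
  by_cases hkj : k = j + 1
  · exact hkj ▸ e
  · exact heq k hk hkj

/-! ### Polygon moves of chains are moves of trees -/

lemma leafSet_mem_parts_iff (hv : v ∈ verts n) :
    T.leafSet v ∈ (T.partitionAt i).parts ↔ v ∈ T.roots (n + 1 + i) := by
  rw [parts_partitionAt, mem_image]
  constructor
  · rintro ⟨r, hr, h⟩
    rwa [← (leafSet_inj (roots_subset hr) hv).1 h]
  · exact fun h => ⟨v, h, rfl⟩

lemma mem_roots_of_forall_notMem (hv : v ∈ verts n) (hvk : v ≤ k)
    (h : ∀ u, v < u → u ≤ k → v ∉ T.children u) : v ∈ T.roots k :=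
  mem_roots.2 ⟨hv, hvk, fun u hu hvu => h u (T.decreasing _ _ hvu) hu hvu⟩

namespace ChainMove

/-- The leaf set of `n + 1 + i + 1` depends only on the partitions of index `i` and `i + 1`; the two
excluded vertices are those for which the index `j + 1` is involved. -/
lemma leafSet_eq (h : ChainMove T S j) (hv : v ∈ verts n) (h1 : v ≠ n + 1 + j + 1)
    (h2 : v ≠ n + 1 + j + 1 + 1) : T.leafSet v = S.leafSet v := by
  rcases leaf_or_exists_index hv with hv | ⟨i, hi, rfl⟩
  · rw [leafSet_of_le hv, leafSet_of_le hv]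
  · exact leafSet_congr hi (h.eq_of_ne _ (by omega) (by omega))
      (h.eq_of_ne _ (by omega) (by omega))

lemma mem_verts (h : ChainMove T S j) : n + 1 + j + 1 ∈ verts n ∧ n + 1 + j + 1 + 1 ∈ verts n := by
  have := h.lt
  exact ⟨mem_Icc.2 (by omega), mem_Icc.2 (by omega)⟩

/-- Otherwise both partitions of index `j + 1` would cover the common one of index `j` with the same
new block. -/
lemma leafSet_ne (h : ChainMove T S j) :
    T.leafSet (n + 1 + j + 1) ≠ S.leafSet (n + 1 + j + 1) := by
  have hj := h.lt
  intro e
  have hx := h.eq_of_ne j (by omega) (by omega)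
  have hT : T.leafSet (n + 1 + j + 1) ∈
      (T.partitionAt (j + 1)).parts \ (T.partitionAt j).parts := by
    rw [T.partitionAt_succ_sdiff (by omega)]
    exact mem_singleton_self _
  have hS : S.leafSet (n + 1 + j + 1) ∈
      (S.partitionAt (j + 1)).parts \ (S.partitionAt j).parts := by
    rw [S.partitionAt_succ_sdiff (by omega)]
    exact mem_singleton_self _
  exact h.ne (eq_of_covBy_of_new_block (T.partitionAt_covBy (by omega))
    (hx ▸ S.partitionAt_covBy (by omega)) hT (e ▸ (mem_sdiff.1 hS).1))

/-- A leaf set that is new in the partition of index `j + 2` of `T` is new in that of `S`. -/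
lemma leafSet_eq_of_mem_roots (h : ChainMove T S j) (hv : v ∈ T.roots (n + 1 + j + 1 + 1))
    (hv' : n + 1 + j < v) :
    ∃ r, r ∈ S.roots (n + 1 + j + 1 + 1) ∧ (r = n + 1 + j + 1 ∨ r = n + 1 + j + 1 + 1) ∧
      T.leafSet v = S.leafSet r := by
  have hj := h.lt
  have hvv := roots_subset hv
  have h1 : T.leafSet v ∈ (T.partitionAt (j + 2)).parts := (leafSet_mem_parts_iff hvv).2 hv
  have h2 : T.leafSet v ∉ (T.partitionAt j).parts := fun h' => by
    have := (mem_roots.1 ((leafSet_mem_parts_iff hvv).1 h')).2.1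
    omega
  rw [h.eq_of_ne (j + 2) (by omega) (by omega), parts_partitionAt] at h1
  rw [h.eq_of_ne j (by omega) (by omega)] at h2
  obtain ⟨r, hr, hrv⟩ := mem_image.1 h1
  refine ⟨r, hr, ?_, hrv.symm⟩
  by_contra hne
  obtain ⟨hr1, hr2, hr3⟩ := mem_roots.1 hr
  rw [← hrv, leafSet_mem_parts_iff hr1] at h2
  exact h2 (mem_roots.2 ⟨hr1, by omega, fun u hu => hr3 u (by omega)⟩)

lemma last_mem_roots (h : ChainMove T S j) :
    n + 1 + j + 1 + 1 ∈ T.roots (n + 1 + j + 1 + 1) :=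
  mem_roots_of_forall_notMem h.mem_verts.2 le_rfl fun u h1 h2 => by omega

/-- Both vertices are roots at index `j + 2`, so their leaf sets are blocks there that are absent at
index `j`. In `S` such blocks belong to these two vertices only. By `leafSet_ne` the lower one
cannot keep its leaf set, so the two are exchanged. -/
lemma isLabelSwap (h : ChainMove T S j)
    (hu : n + 1 + j + 1 ∉ T.children (n + 1 + j + 1 + 1)) :
    IsLabelSwap (n + 1 + j + 1) (n + 1 + j + 1 + 1) T S := by
  have hj := h.lt
  obtain ⟨hu1, hw1⟩ := h.mem_verts
  have hu2 : n + 1 + j + 1 ∈ T.roots (n + 1 + j + 1 + 1) :=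
    mem_roots_of_forall_notMem hu1 (by omega) fun v h1 h2 => by
      obtain rfl : v = n + 1 + j + 1 + 1 := by omega
      exact hu
  have huw : T.leafSet (n + 1 + j + 1) = S.leafSet (n + 1 + j + 1 + 1) := by
    obtain ⟨r, -, rfl | rfl, hr⟩ := h.leafSet_eq_of_mem_roots hu2 (by omega)
    · exact absurd hr h.leafSet_ne
    · exact hr
  have hwu : T.leafSet (n + 1 + j + 1 + 1) = S.leafSet (n + 1 + j + 1) := by
    obtain ⟨r, -, rfl | rfl, hr⟩ := h.leafSet_eq_of_mem_roots h.last_mem_roots (by omega)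
    · exact hr
    · have := (leafSet_inj hu1 hw1).1 (huw.trans hr.symm)
      omega
  have hmem := mem_children_of_leafSet (T := T) (S := S)
    (Equiv.swap (n + 1 + j + 1) (n + 1 + j + 1 + 1)) (fun v => swap_mem_verts hu1 hw1) (by
      intro v hv
      by_cases h1 : v = n + 1 + j + 1
      · rw [h1, Equiv.swap_apply_left, huw]
      by_cases h2 : v = n + 1 + j + 1 + 1
      · rw [h2, Equiv.swap_apply_right, hwu]
      rw [Equiv.swap_apply_of_ne_of_ne h1 h2, h.leafSet_eq hv h1 h2])
  refine ⟨?_, fun v => ?_⟩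
  · have hroot : n + 1 + j + 1 ≠ T.root := by
      rw [T.root_eq]
      omega
    obtain ⟨p, hp⟩ := exists_parent hu1 hroot
    have h1 := T.decreasing _ _ hp
    have h2 := mem_Icc.1 (mem_verts_of_mem_children hp)
    have h3 : p ≠ n + 1 + j + 1 + 1 := fun e => hu (e ▸ hp)
    rw [T.root_eq, S.root_eq, Equiv.swap_apply_of_ne_of_ne (by omega) (by omega)]
  · ext c
    rw [mem_image]
    constructor
    · intro hc
      refine ⟨Equiv.swap _ _ c, (hmem v _).1 ?_, Equiv.swap_apply_self _ _ c⟩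
      rwa [Equiv.swap_apply_self]
    · rintro ⟨d, hd, rfl⟩
      exact (hmem v d).2 hd

/-- The blocks merged in the two steps are the same for both trees. -/
lemma mem_children_or (h : ChainMove T S j) (hc : c ≠ n + 1 + j + 1)
    (hT : c ∈ T.children (n + 1 + j + 1) ∨ c ∈ T.children (n + 1 + j + 1 + 1)) :
    c ∈ S.children (n + 1 + j + 1) ∨ c ∈ S.children (n + 1 + j + 1 + 1) := by
  have hj := h.lt
  have hcv : c ∈ verts n := by
    rcases hT with hT | hT
    · exact T.children_subset _ hT
    · exact T.children_subset _ hT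
  have hlt : c < n + 1 + j + 1 := by
    rcases hT with hT | hT
    · exact T.decreasing _ _ hT
    · have := T.decreasing _ _ hT
      omega
  have hL := h.leafSet_eq hcv (by omega) (by omega)
  have h1 : c ∈ S.roots (n + 1 + j) := by
    rw [← leafSet_mem_parts_iff hcv, ← hL, ← h.eq_of_ne j (by omega) (by omega),
      leafSet_mem_parts_iff hcv]
    refine mem_roots.2 ⟨hcv, by omega, fun v hv hcv => ?_⟩
    rcases hT with hT | hT
    · have := parent_unique hT hcv
      omega
    · have := parent_unique hT hcv
      omega
  have h2 : c ∉ S.roots (n + 1 + j + 1 + 1) := by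
    intro h2
    have h3 := (leafSet_mem_parts_iff (i := j + 2) hcv).2 h2
    rw [← hL, ← h.eq_of_ne (j + 2) (by omega) (by omega), leafSet_mem_parts_iff hcv] at h3
    rcases hT with hT | hT
    · exact (mem_roots.1 h3).2.2 _ (by omega) hT
    · exact (mem_roots.1 h3).2.2 _ (by omega) hT
  by_contra hS
  rw [not_or] at hS
  refine h2 (mem_roots.2 ⟨hcv, by omega, fun v hv => ?_⟩)
  by_cases e1 : v = n + 1 + j + 1
  · exact e1 ▸ hS.1
  by_cases e2 : v = n + 1 + j + 1 + 1
  · exact e2 ▸ hS.2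
  exact (mem_roots.1 h1).2.2 v (by omega)

/-- Otherwise a label swap would carry the edge of `T` to one of `S` whose child has the larger
label. -/
lemma mem_children_symm (h : ChainMove T S j)
    (hu : n + 1 + j + 1 ∈ T.children (n + 1 + j + 1 + 1)) :
    n + 1 + j + 1 ∈ S.children (n + 1 + j + 1 + 1) := by
  by_contra hS
  have hw := h.symm.isLabelSwap hS
  have := hw.symm.mem_children hu
  rw [Equiv.swap_apply_left, Equiv.swap_apply_right] at this
  have := S.decreasing _ _ this
  omega

lemma mem_children_of_ne (h : ChainMove T S j)
    (hu : n + 1 + j + 1 ∈ T.children (n + 1 + j + 1 + 1))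
    (hw : T.leafSet (n + 1 + j + 1 + 1) = S.leafSet (n + 1 + j + 1 + 1))
    (h1 : v ≠ n + 1 + j + 1) (h2 : v ≠ n + 1 + j + 1 + 1) (hc : c ∈ T.children v) :
    c ∈ S.children v := by
  have hv := mem_Icc.1 (mem_Icc_of_mem_children hc)
  obtain ⟨i, rfl⟩ : ∃ i, v = n + 1 + i + 1 := ⟨v - (n + 2), by omega⟩
  have hi : i < n := by omega
  rw [mem_children_iff_mem_sdiff hi] at hc ⊢
  have hL : T.leafSet c = S.leafSet c := by
    by_cases e : c = n + 1 + j + 1 + 1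
    · rw [e, hw]
    · refine h.leafSet_eq hc.1 (fun e' => h2 ?_) e
      rw [← mem_children_iff_mem_sdiff hi, e'] at hc
      exact parent_unique hc hu
  rwa [← hL, ← h.eq_of_ne i (by omega) (by omega), ← h.eq_of_ne (i + 1) (by omega) (by omega)]

lemma exists_other_child (T : DecTree n) (hu : u ∈ T.children w) :
    ∃ b ∈ T.children w, b ≠ u ∧ T.children w = {u, b} := by
  obtain ⟨b, c, hbc, h⟩ := T.children_eq_pair (mem_Icc_of_mem_children hu)
  rw [h] at hu ⊢
  rcases mem_insert.1 hu with rfl | hu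
  · exact ⟨c, by simp, hbc.symm, rfl⟩
  · rw [mem_singleton] at hu
    subst hu
    exact ⟨b, by simp, hbc, pair_comm _ _⟩

/-- Both trees join the same three blocks and differ in the one left out of the first merge, that of
`b` in `T` and of `d` in `S`. Equal choices would make the first merges equal, so exchanging `b` and
`d` turns `T` into `S`. -/
lemma isSubtreeSwap (h : ChainMove T S j)
    (hu : n + 1 + j + 1 ∈ T.children (n + 1 + j + 1 + 1)) :
    IsSubtreeSwap (n + 1 + j + 1) (n + 1 + j + 1 + 1) T S := by
  have hj := h.lt
  have hu' := h.mem_children_symm hu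
  obtain ⟨b, hb, hbu, hTw⟩ := exists_other_child T hu
  obtain ⟨d, hd, hdu, hSw⟩ := exists_other_child S hu'
  have hw : T.leafSet (n + 1 + j + 1 + 1) = S.leafSet (n + 1 + j + 1 + 1) := by
    obtain ⟨r, hr, rfl | rfl, hr'⟩ := h.leafSet_eq_of_mem_roots h.last_mem_roots (by omega)
    · exact absurd hu' ((mem_roots.1 hr).2.2 _ le_rfl)
    · exact hr'
  have hself : ∀ {R : DecTree n} {c v}, c ∈ R.children v → c ∈ R.children (v + 1) → False := by
    intro R c v h1 h2
    have := parent_unique h1 h2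
    omega
  have hne : ∀ {R : DecTree n} {c v}, c ∈ R.children v → c ≠ v := fun hc =>
    (decreasing _ _ _ hc).ne
  have hbd : b ≠ d := by
    rintro rfl
    refine h.leafSet_ne ?_
    have : T.children (n + 1 + j + 1) = S.children (n + 1 + j + 1) := by
      ext c
      constructor
      · intro hc
        refine (h.mem_children_or (hne hc) (Or.inl hc)).resolve_right fun hc' => hself hc ?_
        rwa [hTw, ← hSw]
      · intro hc
        refine (h.symm.mem_children_or (hne hc) (Or.inl hc)).resolve_right fun hc' => hself hc ?_
        rwa [hSw, ← hTw]
    rw [leafSet_eq_biUnion (by omega), leafSet_eq_biUnion (by omega), this]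
    refine biUnion_congr rfl fun c hc => ?_
    have := S.decreasing _ _ hc
    exact h.leafSet_eq (S.children_subset _ hc) (by omega) (by omega)
  have hdT : d ∈ T.children (n + 1 + j + 1) :=
    (h.symm.mem_children_or hdu (Or.inr hd)).resolve_right fun h' => by
      rw [hTw, mem_insert, mem_singleton] at h'
      exact h'.elim hdu hbd.symm
  have hbS : b ∈ S.children (n + 1 + j + 1) :=
    (h.mem_children_or hbu (Or.inr hb)).resolve_right fun h' => by
      rw [hSw, mem_insert, mem_singleton] at h'
      exact h'.elim hbu hbd
  refine ⟨hu, b, hb, hbu, d, hdT, S.root_eq.trans T.root_eq.symm, ?_, ?_, fun v h1 h2 => ?_⟩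
  · rw [hTw, hSw]
    ext c
    simp only [mem_insert, mem_erase, mem_singleton]
    constructor
    · rintro (rfl | rfl)
      · exact Or.inr ⟨hbu.symm, Or.inl rfl⟩
      · exact Or.inl rfl
    · tauto
  · ext c
    simp only [mem_insert, mem_erase]
    constructor
    · intro hc
      rcases h.symm.mem_children_or (hne hc) (Or.inl hc) with h' | h'
      · exact Or.inr ⟨fun e => hself hc (e ▸ hd), h'⟩
      · rw [hTw, mem_insert, mem_singleton] at h'
        exact Or.inl (h'.resolve_left (hne hc))
    · rintro (rfl | ⟨h1, hc⟩)
      · exact hbS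
      · refine (h.mem_children_or (hne hc) (Or.inl hc)).resolve_right fun h' => ?_
        rw [hSw, mem_insert, mem_singleton] at h'
        exact h'.elim (hne hc) h1
  · ext c
    exact ⟨h.symm.mem_children_of_ne hu' hw.symm h1 h2, h.mem_children_of_ne hu hw h1 h2⟩

end ChainMove

/-- The moves of trees correspond to the polygon moves of their chains. -/
lemma move_iff_polygonMove :
    Move T S ↔ PolygonMove (maxMinLabel n) T.toMaxChain S.toMaxChain := by
  rw [polygonMove_toMaxChain_iff]
  constructor
  · rintro ⟨i, hi1, hi2, h, hlt⟩
    obtain ⟨j, rfl⟩ : ∃ j, i = j + 1 := ⟨i - 1, by omega⟩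
    exact ⟨j, h.elim (fun h => h.chainMove hi2) fun h => h.chainMove hi2, hlt⟩
  · rintro ⟨j, h, hlt⟩
    refine ⟨j + 1, by omega, h.lt, ?_, hlt⟩
    by_cases hu : n + 1 + j + 1 ∈ T.children (n + 1 + j + 1 + 1)
    · exact Or.inr (h.isSubtreeSwap hu)
    · exact Or.inl (h.isLabelSwap hu)

/-- By surjectivity every intermediate chain comes from a tree, so paths of polygon moves lift to
paths of moves. -/
lemma treeLE_iff_descentLE :
    TreeLE T S ↔ DescentLE (maxMinLabel n) T.toMaxChain S.toMaxChain := by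
  constructor
  · exact Relation.ReflTransGen.lift toMaxChain (fun _ _ h => move_iff_polygonMove.1 h) T S
  · intro h
    generalize hm : S.toMaxChain = m at h
    induction h generalizing S with
    | refl => exact toMaxChain_injective hm ▸ .refl
    | @tail m₁ m₂ _ hmove ih =>
      obtain ⟨R, rfl⟩ := toMaxChain_surjective m₁
      subst hm
      exact (ih rfl).tail (move_iff_polygonMove.2 hmove)

lemma inversions_of_move (h : Move T S) :
    inversions (labelSeq (maxMinLabel n) S.toMaxChain.1) =
      inversions (labelSeq (maxMinLabel n) T.toMaxChain.1) + 1 :=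
  inversions_of_polygonMove (move_iff_polygonMove.1 h)

end DecTree

end ChainDescent

theorem mainTheorem9 (n : ℕ) (hn : 1 ≤ n) :
    ChainDescent.IsELLabeling (ChainDescent.maxMinLabel n) ∧
    IsPartialOrder (ChainDescent.DecTree n) ChainDescent.DecTree.TreeLE ∧
    IsPartialOrder (ChainDescent.MaxChain (ChainDescent.PartitionLattice n))
      (ChainDescent.DescentLE (ChainDescent.maxMinLabel n)) ∧
    (∃ c : ChainDescent.DecTree n → ChainDescent.MaxChain (ChainDescent.PartitionLattice n),
      (∀ T, (c T).1 = T.chainList) ∧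
      Function.Bijective c ∧
      ∀ T S, ChainDescent.DecTree.TreeLE T S ↔
        ChainDescent.DescentLE (ChainDescent.maxMinLabel n) (c T) (c S)) ∧
    ∀ T S : ChainDescent.DecTree n,
      ChainDescent.CoversIn ChainDescent.DecTree.TreeLE T S ↔ ChainDescent.DecTree.Move T S :=
  ⟨ChainDescent.isELLabeling_maxMinLabel n,
    ChainDescent.isPartialOrder_reflTransGen fun _ _ h => ChainDescent.DecTree.inversions_of_move h,
    ChainDescent.isPartialOrder_descentLE n,
    ⟨ChainDescent.DecTree.toMaxChain, fun _ => rfl,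
      ⟨ChainDescent.DecTree.toMaxChain_injective, ChainDescent.DecTree.toMaxChain_surjective⟩,
      fun _ _ => ChainDescent.DecTree.treeLE_iff_descentLE⟩,
    fun _ _ => ChainDescent.coversIn_reflTransGen_iff
      fun _ _ h => ChainDescent.DecTree.inversions_of_move h⟩
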